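/- **Setting.** Let $q\ge 2$ and let $\mathcal X$ be (the vertex set of) a homogeneous tree of degree $q+1$, with graph distance $d$, a fixed reference vertex $o$ and $|x|=d(o,x)$. Let $1\le p<2$ and $S_p=\{z\in\mathbb C:|\Im z|\le \tfrac1p-\tfrac12\}$. The Schwartz space $\mathcal S_p(\mathcal X)$ consists of all $\phi:\mathcal X\to\mathbb C$ with $$\nu_{p,m}(\phi)=\sup_{x\in\mathcal X}(1+|x|)^m q^{|x|/p}|\phi(x)|<\infty\quad\text{for all integers } m\ge 0 .$$ An $L^p$-tempered distribution is a linear functional $T:\mathcal S_p(\mathcal X)\to\mathbb C$ with $\langle T,\phi_n\rangle\to0$ whenever $\nu_{p,m}(\phi_n)\to0$ for all $m\ge 0$. A multiplier on $\mathcal S_p(\mathcal X)$ is an operator $\Lambda\phi(x)=\phi*k(x)=\sum_{y\in\mathcal X}\phi(y)\,k(d(x,y))$, where $k$ is a radial function on $\mathcal X$ (its value at $x$, written $k(|x|)$, depends only on $|x|$), that maps $\mathcal S_p(\mathcal X)$ to itself by absolutely convergent sums and satisfies: for every $m\ge 0$ there is $C_m>0$ with $\nu_{p,m}(\phi*k)\le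 C_m\,\nu_{p,m}(\phi)$ for all $\phi\in\mathcal S_p(\mathcal X)$. Its symbol is the spherical Fourier transform $\kappa(z)=\sum_{x\in\mathcal X}k(|x|)\phi_z(x)$, $z\in S_p$. Here $\phi_z$ is the elementary spherical function, that is, the unique radial function with $\phi_z(o)=1$ and $\mathcal L\phi_z=\gamma(z)\phi_z$, where $\mathcal Lf(x)=f(x)-\frac1{q+1}\sum_{d(x,y)=1}f(y)$ and $\gamma(z)=1-\frac{q^{1/2+iz}+q^{1/2-iz}}{q+1}$. The multiplier is nontrivial if $\kappa(z)\ne0$ for some $z\in S_p$. It acts on $L^p$-tempered distributions by $\langle\Lambda T,\phi\rangle=\langle T,\Lambda\phi\rangle$. **Theorem.** Let $\Lambda$ be a nontrivial multiplier on $\mathcal S_p(\mathcal X)$ with symbol $\kappa$. Let $(T_k)_{k\in\mathbb Z}$ be a bi-infinite sequence of $L^p$-tempered distributions on $\mathcal X$ such that 1. there is a nonzero $A\in\mathbb C$ with $\Lambda T_k=A\,T_{k+1}$ for all $k\in\mathbb Z$; 2. there are an integer $m\ge 0$ and a constant $M>0$ with $|\langle T_k,\phi\rangle|\le M\,\nu_{p,m}(\phi)$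 for all $k\in\mathbb Z$ and all $\phi\in\mathcal S_p(\mathcal X)$. Then $\max\{|\kappa(z)|:z\in S_p\}$ exists, and the following hold. (a) If $|A|=\max\{|\kappa(z)|:z\in S_p\}$ and the range $\kappa(S_p)$ meets the circle $\{w\in\mathbb C:|w|=|A|\}$ in exactly finitely many distinct points $A_1,\dots,A_j$, then $T_0$ can be written in exactly one way as $$T_0=T_{0,1}+T_{0,2}+\dots+T_{0,j}$$ with $L^p$-tempered distributions $T_{0,i}$ satisfying $\Lambda T_{0,i}=A_iT_{0,i}$ for $i=1,\dots,j$. (b) If $|A|>\max\{|\kappa(z)|:z\in S_p\}$, then $T_0=0$. -/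

import Mathlib

open Filter Topology

noncomputable section

namespace HomTree

/-! ## Spherical functions on a homogeneous tree of degree `q + 1` with reference point `o` -/

/-- The strip `S_p = {z : |Im z| ≤ |1/p - 1/2|}`. -/
def strip (p : ℝ) : Set ℂ := {z | |z.im| ≤ |1 / p - 1 / 2|}

/-- `γ(z) = 1 - (q^(1/2 + iz) + q^(1/2 - iz)) / (q + 1)`. -/
def gam (q : ℕ) (z : ℂ) : ℂ :=
  1 - ((q : ℂ) ^ (1 / 2 + Complex.I * z) + (q : ℂ) ^ (1 / 2 - Complex.I * z)) / ((q : ℂ) + 1)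

/-- The Laplacian `ℒ f(x) = f(x) - (q + 1)⁻¹ ∑_{d(x,y) = 1} f(y)`. -/
def laplacian {V : Type*} (G : SimpleGraph V) [G.LocallyFinite] (q : ℕ) (f : V → ℂ) (x : V) : ℂ :=
  f x - (1 / ((q : ℂ) + 1)) * ∑ y ∈ G.neighborFinset x, f y

/-- A function is radial when its value at `x` depends only on `|x| = d(o, x)`. -/
def IsRadial {V : Type*} (G : SimpleGraph V) (o : V) (f : V → ℂ) : Prop :=
  ∀ x y : V, G.dist o x = G.dist o y → f x = f y

/-- The value of the elementary spherical function `φ_z` on the sphere of radius `n` about `o`.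
It is determined by `φ_z(o) = 1` and `ℒ φ_z = γ(z) φ_z`, see `eq_sphericalFunction_iff`. -/
def sphericalValue (q : ℕ) (z : ℂ) : ℕ → ℂ
  | 0 => 1
  | 1 => 1 - gam q z
  | n + 2 =>
    (((q : ℂ) + 1) * (1 - gam q z) * sphericalValue q z (n + 1) - sphericalValue q z n) / (q : ℂ)

/-- The elementary spherical function `φ_z`: the radial eigenfunction of the Laplacian with
eigenvalue `γ(z)` and `φ_z(o) = 1` (equivalently, the Poisson transform of the constant `1`). -/
def sphericalFunction {V : Type*} (G : SimpleGraph V) (o : V) (q : ℕ) (z : ℂ) (x : V) : ℂ :=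
  sphericalValue q z (G.dist o x)

/-- In a tree every vertex other than `o` has exactly one neighbour closer to `o`. -/
theorem exists_parent {V : Type*} {G : SimpleGraph V} [G.LocallyFinite] (hG : G.IsTree) (o : V)
    {x : V} {n : ℕ} (hx : G.dist o x = n + 1) :
    ∃ y ∈ G.neighborFinset x, G.dist o y = n ∧
      ∀ w ∈ G.neighborFinset x, w ≠ y → G.dist o w = n + 2 := by
  classical
  obtain ⟨P, hP, hPl⟩ := hG.connected.exists_path_of_dist o x
  have hnn : ¬ P.Nil := by
    intro h
    have := SimpleGraph.Walk.length_eq_zero_iff.mpr h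
    omega
  have hadj : G.Adj P.penultimate x := P.adj_penultimate hnn
  have huniq : ∀ w, G.Adj x w → G.dist o w = n → w = P.penultimate := by
    intro w hw hd
    obtain ⟨Q, hQ, hQl⟩ := hG.connected.exists_path_of_dist o w
    have hQ' : (Q.concat hw.symm).length = G.dist o x := by
      rw [SimpleGraph.Walk.length_concat]; omega
    have hQp := (Q.concat hw.symm).isPath_of_length_eq_dist hQ'
    have : Q.concat hw.symm = P := (hG.existsUnique_path o x).unique hQp hP
    rw [← this]; simp
  have h1 : G.dist o P.penultimate = n := by
    have h2 : P.dropLast.length + 1 = P.length := SimpleGraph.Walk.length_dropLast_add_one hnn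
    have h3 := SimpleGraph.dist_le P.dropLast
    rcases hG.dist_eq_dist_add_one_of_adj o hadj with h | h <;> omega
  refine ⟨P.penultimate, by simpa using hadj.symm, h1, fun w hw hne => ?_⟩
  have hw' : G.Adj x w := by simpa using hw
  rcases hG.dist_eq_dist_add_one_of_adj o hw' with h | h
  · exact absurd (huniq w hw' (by omega)) hne
  · omega

theorem sum_neighbors {V : Type*} {G : SimpleGraph V} [G.LocallyFinite] (hG : G.IsTree) {q : ℕ}
    (hreg : G.IsRegularOfDegree (q + 1)) (o : V) (F : ℕ → ℂ) {x : V} {n : ℕ}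
    (hx : G.dist o x = n + 1) :
    ∑ y ∈ G.neighborFinset x, F (G.dist o y) = F n + q * F (n + 2) := by
  classical
  obtain ⟨y, hy, hyn, hr⟩ := exists_parent hG o hx
  rw [← Finset.add_sum_erase _ _ hy, hyn]
  congr 1
  rw [Finset.sum_congr rfl (g := fun _ => F (n + 2))
    (fun w hw => by rw [hr w (Finset.mem_of_mem_erase hw) (Finset.ne_of_mem_erase hw)])]
  rw [Finset.sum_const, Finset.card_erase_of_mem hy, SimpleGraph.card_neighborFinset_eq_degree,
    hreg x]
  simp

theorem sum_neighbors_zero {V : Type*} {G : SimpleGraph V} [G.LocallyFinite] {q : ℕ}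
    (hreg : G.IsRegularOfDegree (q + 1)) (o : V) (F : ℕ → ℂ) :
    ∑ y ∈ G.neighborFinset o, F (G.dist o y) = ((q : ℂ) + 1) * F 1 := by
  rw [Finset.sum_congr rfl (g := fun _ => F 1)
    (fun w hw => by rw [SimpleGraph.dist_eq_one_iff_adj.mpr (by simpa using hw)])]
  rw [Finset.sum_const, SimpleGraph.card_neighborFinset_eq_degree, hreg o]
  simp

/-- `φ_z` is the one and only radial eigenfunction of the Laplacian with eigenvalue `γ(z)` that
takes the value `1` at the reference point. -/
theorem eq_sphericalFunction_iff {V : Type*} (G : SimpleGraph V) [G.LocallyFinite] (q : ℕ)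
    (hq : 2 ≤ q) (hG : G.IsTree) (hreg : G.IsRegularOfDegree (q + 1)) (o : V) (z : ℂ)
    (f : V → ℂ) :
    f = sphericalFunction G o q z ↔
      IsRadial G o f ∧ f o = 1 ∧ ∀ x, laplacian G q f x = gam q z * f x := by
  have hq0 : (q : ℂ) ≠ 0 := by exact_mod_cast (by omega : q ≠ 0)
  have hq1 : (q : ℂ) + 1 ≠ 0 := by exact_mod_cast (by omega : q + 1 ≠ 0)
  constructor
  · rintro rfl
    refine ⟨fun x y h => by simp [sphericalFunction, h], by
      simp [sphericalFunction, sphericalValue], fun x => ?_⟩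
    unfold laplacian sphericalFunction
    rcases hn : G.dist o x with _ | n
    · have : o = x := (hG.connected.dist_eq_zero_iff).mp hn
      subst this
      rw [sum_neighbors_zero hreg]
      simp only [sphericalValue]
      field_simp
      ring
    · rw [sum_neighbors hG hreg o _ hn, sphericalValue]
      field_simp
      ring
  · rintro ⟨hrad, h0, hL⟩
    have key : ∀ n : ℕ, (∀ x, G.dist o x = n → f x = sphericalValue q z n) ∧
        (∀ x, G.dist o x = n + 1 → f x = sphericalValue q z (n + 1)) := by
      intro n
      induction n with
      | zero =>
        refine ⟨fun x hx => ?_, fun x hx => ?_⟩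
        · have : o = x := (hG.connected.dist_eq_zero_iff).mp hx
          subst this
          simpa [sphericalValue] using h0
        · have h := hL o
          unfold laplacian at h
          rw [Finset.sum_congr rfl (g := fun _ => f x) (fun w hw => hrad w x (by
            rw [hx, SimpleGraph.dist_eq_one_iff_adj.mpr (by simpa using hw)]))] at h
          rw [Finset.sum_const, SimpleGraph.card_neighborFinset_eq_degree, hreg o, h0] at h
          simp only [nsmul_eq_mul, Nat.cast_add, Nat.cast_one] at h
          rw [one_div, inv_mul_cancel_left₀ hq1] at h
          simp only [sphericalValue]
          linear_combination -h
      | succ n ih =>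
        refine ⟨ih.2, fun x hx => ?_⟩
        classical
        obtain ⟨y, hy, hyn, -⟩ := exists_parent hG o hx
        obtain ⟨w, hw, hwn, hr⟩ := exists_parent hG o hyn
        have h := hL y
        unfold laplacian at h
        rw [← Finset.add_sum_erase _ _ hw, Finset.sum_congr rfl (g := fun _ => f x)
          (fun v hv => hrad v x (by
            rw [hx, hr v (Finset.mem_of_mem_erase hv) (Finset.ne_of_mem_erase hv)]))] at h
        rw [Finset.sum_const, Finset.card_erase_of_mem hw,
          SimpleGraph.card_neighborFinset_eq_degree, hreg y, ih.1 w hwn, ih.2 y hyn] at h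
        simp only [nsmul_eq_mul, Nat.add_sub_cancel] at h
        rw [show n + 1 + 1 = n + 2 from rfl, sphericalValue]
        field_simp at h ⊢
        linear_combination -h
    funext x
    exact (key _).1 x rfl

/-! ## Schwartz spaces and tempered distributions -/

/-- The weighted values `(1 + |x|)^m q^(|x|/p) |φ(x)|`. -/
def weighted {V : Type*} (G : SimpleGraph V) (o : V) (q : ℕ) (p : ℝ) (m : ℕ) (φ : V → ℂ) (x : V) :
    ℝ :=
  (1 + (G.dist o x : ℝ)) ^ m * (q : ℝ) ^ ((G.dist o x : ℝ) / p) * ‖φ x‖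

/-- The seminorm `ν_{p,m}(φ) = sup_x (1 + |x|)^m q^(|x|/p) |φ(x)|`. -/
def nu {V : Type*} (G : SimpleGraph V) (o : V) (q : ℕ) (p : ℝ) (m : ℕ) (φ : V → ℂ) : ℝ :=
  ⨆ x : V, weighted G o q p m φ x

/-- The Schwartz space `𝒮_p` of all `φ` with `ν_{p,m}(φ) < ∞` for every `m`. -/
def Schwartz {V : Type*} (G : SimpleGraph V) (o : V) (q : ℕ) (p : ℝ) : Submodule ℂ (V → ℂ) where
  carrier := {φ | ∀ m : ℕ, BddAbove (Set.range (weighted G o q p m φ))}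
  add_mem' := by
    intro a b ha hb m
    obtain ⟨A, hA⟩ := ha m
    obtain ⟨B, hB⟩ := hb m
    refine ⟨A + B, ?_⟩
    rintro _ ⟨x, rfl⟩
    have h1 := hA ⟨x, rfl⟩
    have h2 := hB ⟨x, rfl⟩
    unfold weighted at *
    calc _ ≤ (1 + (G.dist o x : ℝ)) ^ m * (q : ℝ) ^ ((G.dist o x : ℝ) / p) * (‖a x‖ + ‖b x‖) := by
          gcongr; exact norm_add_le _ _
      _ ≤ A + B := by linarith
  zero_mem' := by
    intro m
    refine ⟨0, ?_⟩
    rintro _ ⟨x, rfl⟩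
    simp [weighted]
  smul_mem' := by
    intro c a ha m
    obtain ⟨A, hA⟩ := ha m
    refine ⟨‖c‖ * A, ?_⟩
    rintro _ ⟨x, rfl⟩
    have h1 := mul_le_mul_of_nonneg_left (hA ⟨x, rfl⟩) (norm_nonneg c)
    refine le_trans (le_of_eq ?_) h1
    simp only [weighted, Pi.smul_apply, smul_eq_mul, norm_mul]
    ring

/-- The `L^p`-tempered distributions: the linear functionals `T` on `𝒮_p` such that
`⟨T, φ_n⟩ → 0` whenever `ν_{p,m}(φ_n) → 0` for every `m`. -/
def Tempered {V : Type*} (G : SimpleGraph V) (o : V) (q : ℕ) (p : ℝ) :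
    Submodule ℂ (Schwartz G o q p →ₗ[ℂ] ℂ) where
  carrier := {T | ∀ φ : ℕ → Schwartz G o q p,
    (∀ m : ℕ, Tendsto (fun n => nu G o q p m (φ n : V → ℂ)) atTop (𝓝 0)) →
      Tendsto (fun n => T (φ n)) atTop (𝓝 0)}
  add_mem' := by
    intro S T hS hT φ hφ
    simpa using (hS φ hφ).add (hT φ hφ)
  zero_mem' := by
    intro φ _
    simp
  smul_mem' := by
    intro c T hT φ hφ
    simpa using (hT φ hφ).const_mul c

/-! ## Multipliers -/

/-- Right convolution with the radial function `y ↦ k |y|`: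
`(φ ∗ k)(x) = ∑_y φ(y) k(d(x, y))`. -/
def conv {V : Type*} (G : SimpleGraph V) (φ : V → ℂ) (k : ℕ → ℂ) (x : V) : ℂ :=
  ∑' y : V, φ y * k (G.dist x y)

/-- A multiplier `Λ` on `𝒮_p`: a radial function, given by its values `k n` on the spheres
`{|x| = n}`, such that `φ ↦ φ ∗ k` is defined from `𝒮_p` to itself (by absolutely convergent sums)
and is bounded for each single seminorm `ν_{p,m}`. -/
structure Multiplier {V : Type*} (G : SimpleGraph V) (o : V) (q : ℕ) (p : ℝ) where
  k : ℕ → ℂ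
  summable' : ∀ φ ∈ Schwartz G o q p, ∀ x : V, Summable fun y : V => φ y * k (G.dist x y)
  mem' : ∀ φ ∈ Schwartz G o q p, conv G φ k ∈ Schwartz G o q p
  bound' : ∀ m : ℕ, ∃ C : ℝ, 0 < C ∧ ∀ φ ∈ Schwartz G o q p,
    nu G o q p m (conv G φ k) ≤ C * nu G o q p m φ

namespace Multiplier

variable {V : Type*} {G : SimpleGraph V} {o : V} {q : ℕ} {p : ℝ}

/-- The symbol `κ(z) = ∑_x k(x) φ_z(x)` of `Λ`, the spherical Fourier transform of `k`. -/
def symbol (Λ : Multiplier G o q p) (z : ℂ) : ℂ :=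
  ∑' x : V, Λ.k (G.dist o x) * sphericalFunction G o q z x

/-- The operator `Λ φ = φ ∗ k` on `𝒮_p`. -/
def op (Λ : Multiplier G o q p) : Schwartz G o q p →ₗ[ℂ] Schwartz G o q p where
  toFun φ := ⟨conv G (φ : V → ℂ) Λ.k, Λ.mem' _ φ.2⟩
  map_add' φ ψ := by
    apply Subtype.ext
    funext x
    change ∑' y : V, ((φ : V → ℂ) y + (ψ : V → ℂ) y) * Λ.k (G.dist x y) =
      (∑' y : V, (φ : V → ℂ) y * Λ.k (G.dist x y)) + ∑' y : V, (ψ : V → ℂ) y * Λ.k (G.dist x y)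
    rw [← (Λ.summable' _ φ.2 x).tsum_add (Λ.summable' _ ψ.2 x)]
    simp only [add_mul]
  map_smul' c φ := by
    apply Subtype.ext
    funext x
    change ∑' y : V, (c * (φ : V → ℂ) y) * Λ.k (G.dist x y) =
      c * ∑' y : V, (φ : V → ℂ) y * Λ.k (G.dist x y)
    rw [← tsum_mul_left]
    simp only [mul_assoc]

/-- The action of `Λ` on `L^p`-tempered distributions: `⟨Λ T, φ⟩ = ⟨T, Λ φ⟩`. -/
def act (Λ : Multiplier G o q p) : Tempered G o q p →ₗ[ℂ] Tempered G o q p where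
  toFun T := ⟨(T : Schwartz G o q p →ₗ[ℂ] ℂ).comp Λ.op, by
    intro φ hφ
    refine T.2 (fun n => Λ.op (φ n)) fun m => ?_
    obtain ⟨C, -, hC⟩ := Λ.bound' m
    have h0 : ∀ f : V → ℂ, 0 ≤ nu G o q p m f := fun f =>
      Real.iSup_nonneg fun x => by unfold weighted; positivity
    refine squeeze_zero (fun n => h0 _) (fun n => hC _ (φ n).2) ?_
    simpa using (hφ m).const_mul C⟩
  map_add' _ _ := rfl
  map_smul' _ _ := rfl

end Multiplier

end HomTree

end

/-!
Write `U = A⁻¹ Λ`, acting on the Banach space `D` of distributions of order at most `m`, the dual of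
the Schwartz space with the single seminorm `ν_{p,m}`. The `T k` form a bounded two-sided orbit of
`U` in `D`. The theorem follows from two facts.

*Spectrum.* The spectrum of `Λ` on `D` is contained in `κ(S_p)`. The operators `L n` of summation over
spheres of radius `n` are polynomials in `L 1` (`HeckeSeq`), have norm at most
`(1 + n)^(m + 1) q^(n / p)` (`weighted_sphereSum_le`), and `Λ = ∑ k(n) L n` in norm
(`Multiplier.hasSum_clm`). A character of the closed algebra generated by `L 1` sends `L` to the
sequence of sphere sums of a spherical function `φ_z`; since a character is bounded, the growth of
the `L n` forces `z ∈ S_p`, and the character then takes the value `κ(z)` at `Λ`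
(`isUnit_sub_of_forall_not_hasSum`).

*Bounded orbits.* If the spectrum of `U` meets the unit circle in a finite set `F`, then
`∏_{α ∈ F} (U - α)` annihilates every bounded two-sided orbit (`aeval_prod_apply_eq_zero`,
`exists_carlemanExtension`). The two
halves of the orbit are the expansions, inside and outside the unit disc, of one function that the
resolvent of `U` continues analytically across the circle off `F`. It is `O(1 / |‖w‖ - 1|)`, which
forces its singularities to be simple poles (`eventually_norm_mul_le`). Hence each factor `U - α`
removes one singularity, and when none is left the function is entire and vanishes at infinity, so
that it is zero. This argument does not need any control of the rate at which `|κ|` approaches its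
maximum.

With `F` the values of `κ` on the circle of radius `‖A‖`, divided by `A`, this yields
`∏ (Λ - A_i) T 0 = 0`. Lagrange interpolation turns this into the decomposition and its uniqueness
(`existsUnique_eigen_decomposition`); when `‖A‖` exceeds the maximum of `|κ|` the product is empty and
`T 0 = 0`.
-/

noncomputable section

namespace HomTree

/-! ### Hecke sequences and the spectrum in a Banach algebra -/

/-- A sequence `L` in a ring satisfying the relations of the sphere operators on a homogeneous tree
of degree `q + 1`; it is a sequence of polynomials in `L 1`. -/
structure HeckeSeq {B : Type*} [Ring B] (q : ℕ) (L : ℕ → B) : Prop where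
  zero : L 0 = 1
  one : L 1 * L 1 = L 2 + ((q : B) + 1)
  step : ∀ n, L 1 * L (n + 2) = L (n + 3) + (q : B) * L (n + 1)

namespace HeckeSeq

variable {B C : Type*} [Ring B] [Ring C] {q : ℕ} {L : ℕ → B}

theorem map (h : HeckeSeq q L) {F : Type*} [FunLike F B C] [RingHomClass F B C] (f : F) :
    HeckeSeq q fun n => f (L n) where
  zero := by simp [h.zero]
  one := by rw [← map_mul, h.one]; simp
  step n := by rw [← map_mul, h.step]; simp

theorem mem_of_mem (h : HeckeSeq q L) (S : Subring B) (h1 : L 1 ∈ S) (n : ℕ) : L n ∈ S := by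
  have h0 : L 0 ∈ S := h.zero ▸ S.one_mem
  have hq : (q : B) ∈ S := natCast_mem S q
  have h2 : L 2 ∈ S := by
    rw [eq_sub_of_add_eq h.one.symm]
    exact S.sub_mem (S.mul_mem h1 h1) (S.add_mem hq S.one_mem)
  have key : ∀ n, L (n + 1) ∈ S ∧ L (n + 2) ∈ S := by
    intro n
    induction n with
    | zero => exact ⟨h1, h2⟩
    | succ n ih =>
      refine ⟨ih.2, ?_⟩
      rw [show n + 1 + 2 = n + 3 from rfl, eq_sub_of_add_eq (h.step n).symm]
      exact S.sub_mem (S.mul_mem h1 ih.2) (S.mul_mem hq ih.1)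
  rcases n with _ | n
  · exact h0
  · exact (key n).1

theorem commute_one (h : HeckeSeq q L) (n : ℕ) : Commute (L 1) (L n) := by
  have := h.mem_of_mem (Subring.centralizer {L 1}) (by simp [Subring.mem_centralizer_iff]) n
  rw [Subring.mem_centralizer_iff] at this
  exact this _ rfl

theorem eq_of_one {L' : ℕ → B} (h : HeckeSeq q L) (h' : HeckeSeq q L') (h1 : L 1 = L' 1) :
    L = L' := by
  have h2 : L 2 = L' 2 := by
    rw [eq_sub_of_add_eq h.one.symm, eq_sub_of_add_eq h'.one.symm, h1]
  have key : ∀ n, L (n + 1) = L' (n + 1) ∧ L (n + 2) = L' (n + 2) := by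
    intro n
    induction n with
    | zero => exact ⟨h1, h2⟩
    | succ n ih =>
      refine ⟨ih.2, ?_⟩
      rw [show n + 1 + 2 = n + 3 from rfl, eq_sub_of_add_eq (h.step n).symm,
        eq_sub_of_add_eq (h'.step n).symm, ih.1, ih.2, h1]
  funext n
  rcases n with _ | n
  · rw [h.zero, h'.zero]
  · exact (key n).1

section Scalar

variable {x : ℕ → ℂ} {v w : ℂ}

/-- With `v`, `w` the roots of `X² - x₁ X + q`, the differences `xₙ₊₁ - w xₙ` are geometric. -/
theorem sub_eq (h : HeckeSeq q x) (h1 : x 1 = v + w) (hvw : v * w = q) (n : ℕ) :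
    x (n + 2) = w * x (n + 1) + v ^ n * (v ^ 2 - 1) := by
  induction n with
  | zero =>
    have := h.one
    rw [h1] at this
    simp only [zero_add, pow_zero, one_mul, h1]
    linear_combination -this + hvw
  | succ n ih =>
    have := h.step n
    rw [h1] at this
    rw [show n + 1 + 2 = n + 3 from rfl, show n + 1 + 1 = n + 2 from rfl]
    linear_combination -this + v * ih + x (n + 1) * hvw

theorem norm_le (h : HeckeSeq q x) (h1 : x 1 = v + w) (hvw : v * w = q) {ρ : ℝ} (hρ : 1 ≤ ρ)
    (hv : ‖v‖ ≤ ρ) (hw : ‖w‖ ≤ ρ) (n : ℕ) : ‖x n‖ ≤ (1 + 2 * n) * ρ ^ n := by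
  have key : ∀ n : ℕ, ‖x (n + 1)‖ ≤ (1 + 2 * (n + 1)) * ρ ^ (n + 1) := by
    intro n
    induction n with
    | zero =>
      rw [zero_add, h1]
      have := norm_add_le v w
      push_cast
      linarith
    | succ n ih =>
      rw [show n + 1 + 1 = n + 2 from rfl, h.sub_eq h1 hvw]
      have hρ0 : 0 ≤ ρ := by linarith
      have e1 : ‖v ^ 2 - 1‖ ≤ 2 * ρ ^ 2 := by
        refine (norm_sub_le _ _).trans ?_
        rw [norm_pow, norm_one]
        have := pow_le_pow_left₀ (norm_nonneg v) hv 2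
        nlinarith
      calc ‖w * x (n + 1) + v ^ n * (v ^ 2 - 1)‖
          ≤ ‖w‖ * ‖x (n + 1)‖ + ‖v‖ ^ n * ‖v ^ 2 - 1‖ := by
            refine (norm_add_le _ _).trans ?_
            rw [norm_mul, norm_mul, norm_pow]
        _ ≤ ρ * ((1 + 2 * (n + 1)) * ρ ^ (n + 1)) + ρ ^ n * (2 * ρ ^ 2) := by gcongr
        _ = _ := by push_cast; ring
  rcases n with _ | n
  · simp [h.zero]
  · exact_mod_cast key n

/-- A growth bound on the sequence confines the root `v` to a disc. -/
theorem norm_root_le (h : HeckeSeq q x) (h1 : x 1 = v + w) (hvw : v * w = q) {ρ C : ℝ} {s : ℕ}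
    (hρ : 1 ≤ ρ) (hx : ∀ n : ℕ, ‖x n‖ ≤ C * ((1 + n) ^ s * ρ ^ n)) : ‖v‖ ≤ ρ := by
  by_contra! hv
  have hv1 : 1 < ‖v‖ := hρ.trans_lt hv
  have hρ0 : 0 < ρ := by linarith
  have hne : 0 < ‖v ^ 2 - 1‖ := by
    rw [norm_pos_iff, sub_ne_zero]
    intro h'
    have : ‖v‖ ^ 2 = 1 := by rw [← norm_pow, h', norm_one]
    nlinarith
  have hC : 0 ≤ C := by
    have := (norm_nonneg _).trans (hx 0)
    simpa using this
  set r := ρ / ‖v‖ with hr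
  have hr1 : r < 1 := (div_lt_one (by linarith)).mpr hv
  have hr0 : 0 < r := by positivity
  have hb : ∀ n : ℕ, ‖v ^ 2 - 1‖ ≤
      (C * (1 + ‖w‖) * ‖v‖ ^ 3) * (((n + 3 : ℕ) : ℝ) ^ s * r ^ (n + 3)) := by
    intro n
    have e1 : v ^ n * (v ^ 2 - 1) = x (n + 2) - w * x (n + 1) := by
      rw [h.sub_eq h1 hvw n]; ring
    have hxn : ∀ i ≤ 2, ‖x (n + i)‖ ≤ C * ((n + 3 : ℝ) ^ s * ρ ^ (n + 3)) := by
      intro i hi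
      have hi' : (i : ℝ) ≤ 2 := by exact_mod_cast hi
      have h3 : ρ ^ (n + i) ≤ ρ ^ (n + 3) := pow_le_pow_right₀ hρ (by omega)
      have h4 : (1 + ((n + i : ℕ) : ℝ)) ^ s ≤ (n + 3 : ℝ) ^ s := by
        refine pow_le_pow_left₀ (by positivity) ?_ s
        push_cast
        linarith
      exact (hx _).trans (by gcongr)
    have e2 : ‖v‖ ^ n * ‖v ^ 2 - 1‖ ≤ C * (1 + ‖w‖) * ((n + 3 : ℝ) ^ s * ρ ^ (n + 3)) := by
      rw [← norm_pow, ← norm_mul, e1]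
      refine (norm_sub_le _ _).trans ?_
      rw [norm_mul]
      have := mul_le_mul_of_nonneg_left (hxn 1 (by norm_num)) (norm_nonneg w)
      have := hxn 2 le_rfl
      linarith
    have hvn : 0 < ‖v‖ ^ n := by positivity
    rw [hr, div_pow, ← mul_div_assoc, ← mul_div_assoc, le_div_iff₀ (by positivity)]
    calc ‖v ^ 2 - 1‖ * ‖v‖ ^ (n + 3) = ‖v‖ ^ n * ‖v ^ 2 - 1‖ * ‖v‖ ^ 3 := by ring
      _ ≤ C * (1 + ‖w‖) * ((n + 3 : ℝ) ^ s * ρ ^ (n + 3)) * ‖v‖ ^ 3 := by gcongr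
      _ = _ := by push_cast; ring
  have ht := tendsto_pow_const_mul_const_pow_of_abs_lt_one s
    (show |r| < 1 by rwa [abs_of_pos hr0])
  have ht' := ((tendsto_add_atTop_iff_nat 3).mpr ht).const_mul (C * (1 + ‖w‖) * ‖v‖ ^ 3)
  rw [mul_zero] at ht'
  have := ge_of_tendsto' ht' hb
  linarith

end Scalar

end HeckeSeq

theorem natCast_cpow_norm {q : ℕ} (hq : 2 ≤ q) (s : ℂ) : ‖(q : ℂ) ^ s‖ = (q : ℝ) ^ s.re :=
  Complex.norm_natCast_cpow_of_pos (by omega) s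

theorem roots_mul {q : ℕ} (hq : 2 ≤ q) (z : ℂ) :
    (q : ℂ) ^ (1 / 2 + Complex.I * z) * (q : ℂ) ^ (1 / 2 - Complex.I * z) = q := by
  rw [← Complex.cpow_add _ _ (by exact_mod_cast (by omega : q ≠ 0))]
  ring_nf
  simp

/-- Every complex number is the value at `1` of the scalar Hecke sequence of some parameter `z`. -/
theorem exists_root {q : ℕ} (hq : 2 ≤ q) (β : ℂ) :
    ∃ z : ℂ, β = (q : ℂ) ^ (1 / 2 + Complex.I * z) + (q : ℂ) ^ (1 / 2 - Complex.I * z) := by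
  have hq0 : (q : ℂ) ≠ 0 := by exact_mod_cast (by omega : q ≠ 0)
  obtain ⟨d, hd⟩ := IsAlgClosed.exists_pow_nat_eq (β ^ 2 - 4 * q) (n := 2) (by norm_num)
  set v := (β + d) / 2 with hv
  have hv1 : v * (β - v) = q := by
    rw [hv]; linear_combination -(1 / 4) * hd
  have hv0 : v ≠ 0 := by
    rintro h
    rw [h, zero_mul] at hv1
    exact hq0 hv1.symm
  have hlog : Complex.log q ≠ 0 := by
    rw [Complex.natCast_log.symm]
    exact_mod_cast (Real.log_pos (by exact_mod_cast (by omega : 1 < q))).ne'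
  refine ⟨-Complex.I * (Complex.log v / Complex.log q - 1 / 2), ?_⟩
  have e : (q : ℂ) ^ (1 / 2 + Complex.I * (-Complex.I * (Complex.log v / Complex.log q - 1 / 2)))
      = v := by
    rw [Complex.cpow_def_of_ne_zero hq0]
    have : Complex.log q * (1 / 2 + Complex.I * (-Complex.I *
        (Complex.log v / Complex.log q - 1 / 2))) = Complex.log v := by
      rw [← mul_assoc, mul_neg, Complex.I_mul_I]
      field_simp
      ring
    rw [this, Complex.exp_log hv0]
  have e' := roots_mul hq (-Complex.I * (Complex.log v / Complex.log q - 1 / 2))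
  rw [e] at e'
  rw [e, mul_left_cancel₀ hv0 (e'.trans hv1.symm)]
  ring

/-- The strip in terms of the roots `v`, `w` of `X² - x₁ X + q` that belong to the parameter `z`. -/
theorem mem_strip_iff {q : ℕ} (hq : 2 ≤ q) {p : ℝ} (hp1 : 1 ≤ p) (hp2 : p < 2) (z : ℂ) :
    z ∈ strip p ↔ ‖(q : ℂ) ^ (1 / 2 + Complex.I * z)‖ ≤ (q : ℝ) ^ (1 / p) ∧
      ‖(q : ℂ) ^ (1 / 2 - Complex.I * z)‖ ≤ (q : ℝ) ^ (1 / p) := by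
  have hq1 : (1 : ℝ) < q := by exact_mod_cast (by omega : 1 < q)
  have hp : 1 / 2 < 1 / p := one_div_lt_one_div_of_lt (by linarith) hp2
  rw [natCast_cpow_norm hq, natCast_cpow_norm hq, Real.rpow_le_rpow_left_iff hq1,
    Real.rpow_le_rpow_left_iff hq1, strip, Set.mem_ofPred_eq, abs_of_pos (sub_pos.mpr hp), abs_le]
  simp only [Complex.add_re, Complex.sub_re, Complex.mul_re, Complex.I_re, Complex.I_im,
    show ((1 : ℂ) / 2).re = 1 / 2 by norm_num]
  constructor
  · rintro ⟨h1, h2⟩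
    constructor <;> linarith
  · rintro ⟨h1, h2⟩
    constructor <;> linarith

/-- In a Banach algebra, the spectrum of `∑ₙ kₙ Lₙ` is contained in the set of values of the symbol
on the strip. The characters of the closed subalgebra generated by `L 1` carry `L` to scalar Hecke
sequences, and the growth of `L` forces their parameters into the strip. -/
theorem isUnit_sub_of_forall_not_hasSum {B : Type*} [NormedRing B] [NormedAlgebra ℂ B]
    [CompleteSpace B] {q : ℕ} (hq : 2 ≤ q) {p : ℝ} (hp1 : 1 ≤ p) (hp2 : p < 2) {L : ℕ → B}
    (hL : HeckeSeq q L) {C : ℝ} {s : ℕ}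
    (hLn : ∀ n : ℕ, ‖L n‖ ≤ C * ((1 + n) ^ s * ((q : ℝ) ^ (1 / p)) ^ n))
    {k : ℕ → ℂ} {Λ : B} (hΛ : HasSum (fun n => k n • L n) Λ) {c : ℂ}
    (hc : ∀ z ∈ strip p, ∀ x : ℕ → ℂ, HeckeSeq q x →
      x 1 = (q : ℂ) ^ (1 / 2 + Complex.I * z) + (q : ℂ) ^ (1 / 2 - Complex.I * z) →
      ¬ HasSum (fun n => k n * x n) c) :
    IsUnit (Λ - algebraMap ℂ B c) := by
  rcases subsingleton_or_nontrivial B with hB | hB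
  · exact isUnit_of_subsingleton _
  set R := Algebra.elemental ℂ (L 1)
  let _ : NormedCommRing R := { (inferInstance : NormedRing R) with mul_comm := mul_comm }
  have hmem : ∀ n, L n ∈ R := hL.mem_of_mem R.toSubring (Algebra.elemental.self_mem ℂ (L 1))
  let L' : ℕ → R := fun n => ⟨L n, hmem n⟩
  have hL' : HeckeSeq q L' :=
    ⟨Subtype.ext hL.zero, Subtype.ext hL.one, fun n => Subtype.ext (hL.step n)⟩
  have hΛR : Λ ∈ R := by
    refine (Algebra.elemental.isClosed ℂ (L 1)).mem_of_tendsto hΛ (.of_forall fun t => ?_)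
    exact R.sum_mem fun n _ => R.smul_mem (hmem n) _
  have hsum : HasSum (fun n => k n • L' n) (⟨Λ, hΛR⟩ : R) := by
    exact (Topology.IsInducing.subtypeVal.hasSum_iff (g := R.val) _ _).mp hΛ
  by_contra hcon
  have hcon' : c ∈ spectrum ℂ (⟨Λ, hΛR⟩ : R) := by
    rw [spectrum.mem_iff]
    intro h
    apply hcon
    have := (h.map R.val).neg
    simpa using this
  rw [WeakDual.CharacterSpace.mem_spectrum_iff_exists] at hcon'
  obtain ⟨χ, hχ⟩ := hcon'
  obtain ⟨z, hz⟩ := exists_root hq (χ (L' 1))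
  have hx : HeckeSeq q fun n => χ (L' n) := hL'.map χ
  have hbound : ∀ n : ℕ, ‖χ (L' n)‖ ≤ (C * ‖(1 : R)‖) * ((1 + n) ^ s * ((q : ℝ) ^ (1 / p)) ^ n) := by
    intro n
    have := spectrum.norm_le_norm_mul_of_mem (AlgHom.apply_mem_spectrum χ (L' n))
    refine this.trans ?_
    have h2 : ‖L' n‖ = ‖L n‖ := rfl
    rw [h2]
    calc _ ≤ _ := mul_le_mul_of_nonneg_right (hLn n) (norm_nonneg _)
      _ = _ := by ring
  have hρ : 1 ≤ (q : ℝ) ^ (1 / p) :=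
    Real.one_le_rpow (by exact_mod_cast (by omega : 1 ≤ q)) (by positivity)
  have hvw := roots_mul hq z
  refine hc z ((mem_strip_iff hq hp1 hp2 z).mpr ⟨hx.norm_root_le hz hvw hρ hbound,
    hx.norm_root_le (hz.trans (add_comm _ _)) ((mul_comm _ _).trans hvw) hρ hbound⟩) _ hx hz ?_
  have := hsum.map χ (map_continuous χ)
  rw [hχ] at this
  convert this using 1
  funext n
  simp

/-! ### Carleman transforms of bounded sequences -/

/-- `f` is an analytic continuation, across the unit circle off the finite set `F`, of the Carleman
transform of the two-sided sequence `a`: inside the unit disc it is the power series of the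
nonpositive half of `a`, outside it is minus the series in `1 / w` of the positive half. -/
structure CarlemanExtension (F : Finset ℂ) (a : ℤ → ℂ) (f : ℂ → ℂ) : Prop where
  differentiableOn : DifferentiableOn ℂ f (F : Set ℂ)ᶜ
  inside : ∀ w : ℂ, ‖w‖ < 1 → f w = ∑' k : ℕ, w ^ k * a (-k)
  outside : ∀ w : ℂ, 1 < ‖w‖ → f w = -∑' k : ℕ, w⁻¹ ^ (k + 1) * a (k + 1)

/-- A quadratic polynomial in `w`, adapted to the circle of radius `r` about a point `b` of the unit
circle: on that circle its modulus is `r * |‖w‖ ^ 2 - 1|`, so that it compensates a singularity of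
order `1 / |‖w‖ - 1|`. -/
theorem norm_sq_add_eq {b w : ℂ} {r : ℝ} (hb : ‖b‖ = 1) (hw : ‖w - b‖ = r) :
    ‖(w - b) ^ 2 + r ^ 2 * (b * w)‖ = r * |‖w‖ ^ 2 - 1| := by
  have h1 : (r : ℂ) ^ 2 = (w - b) * (starRingEnd ℂ) (w - b) := by
    rw [Complex.mul_conj, Complex.normSq_eq_norm_sq, hw]; push_cast; ring
  have h2 : b * (starRingEnd ℂ) b = 1 := by
    rw [Complex.mul_conj, Complex.normSq_eq_norm_sq, hb]; norm_num
  have h3 : w * (starRingEnd ℂ) w = ((‖w‖ ^ 2 : ℝ) : ℂ) := by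
    rw [Complex.mul_conj, Complex.normSq_eq_norm_sq]
  have : (w - b) ^ 2 + r ^ 2 * (b * w) = (w - b) * (b * (((‖w‖ ^ 2 - 1 : ℝ)) : ℂ)) := by
    rw [h1, Complex.ofReal_sub, ← h3, map_sub]
    push_cast
    linear_combination -(w - b) * w * h2
  rw [this, norm_mul, norm_mul, hb, hw, one_mul, Complex.norm_real, Real.norm_eq_abs]

/-- A function that is holomorphic near a point `α` of the unit circle, except at `α`, and is
`O(1 / |‖w‖ - 1|)` has at most a simple pole at `α`. Where `w` is much closer to the unit circle than
to `α`, this is the maximum principle for the product of `f` with the polynomial of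
`norm_sq_add_eq`, on a disc that is centred on the unit circle, contains `w` and avoids `α`. -/
theorem eventually_norm_mul_le {f : ℂ → ℂ} {α : ℂ} (hα : ‖α‖ = 1) {δ M : ℝ} (hδ : 0 < δ)
    (hM : 0 ≤ M)
    (hf : DifferentiableOn ℂ f (Metric.ball α δ \ {α}))
    (hb : ∀ w : ℂ, ‖w‖ ≠ 1 → ‖f w‖ * |‖w‖ - 1| ≤ M) :
    ∀ᶠ w in 𝓝[≠] α, ‖f w‖ * ‖w - α‖ ≤ 12 * M := by
  have hnear : Metric.ball α (min (δ / 4) (1 / 4)) ∈ 𝓝[≠] α :=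
    mem_nhdsWithin_of_mem_nhds (Metric.ball_mem_nhds _ (by positivity))
  filter_upwards [hnear, self_mem_nhdsWithin] with w hw hne
  rw [mem_ball_iff_norm, lt_min_iff] at hw
  have hpos : 0 < ‖w - α‖ := norm_pos_iff.mpr (sub_ne_zero.mpr hne)
  obtain ⟨r, hr⟩ : ∃ r, r = ‖w - α‖ / 2 := ⟨_, rfl⟩
  have hr0 : 0 < r := by linarith
  have hn := abs_norm_sub_norm_le w α
  rw [hα] at hn
  have hn' := abs_le.mp hn
  -- The radial projection of `w` to the unit circle.
  obtain ⟨b, hb'⟩ : ∃ b : ℂ, b = w / (‖w‖ : ℂ) := ⟨_, rfl⟩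
  have hw0 : 0 < ‖w‖ := by linarith
  have hw0' : (‖w‖ : ℂ) ≠ 0 := by exact_mod_cast hw0.ne'
  have hbn : ‖b‖ = 1 := by
    rw [hb', norm_div, Complex.norm_real, norm_norm, div_self hw0.ne']
  have hwb : w = ‖w‖ * b := by rw [hb']; field_simp
  have he : ‖w - b‖ = |‖w‖ - 1| := by
    have : w - b = ((‖w‖ - 1 : ℝ) : ℂ) * b := by push_cast; linear_combination hwb
    rw [this, norm_mul, hbn, Complex.norm_real, Real.norm_eq_abs, mul_one]
  -- If `w` is not close to the unit circle, the hypothesis on `f` suffices.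
  rcases le_or_gt (r / 2) (|‖w‖ - 1|) with hc | hc
  · have h1 : ‖w‖ ≠ 1 := by
      intro h
      rw [h, sub_self, abs_zero] at hc
      linarith
    have h2 := hb w h1
    have h3 := mul_le_mul_of_nonneg_left hc (norm_nonneg (f w))
    have h4 : ‖w - α‖ = 4 * (r / 2) := by linarith
    rw [h4]
    nlinarith
  -- Here the disc of radius `r` about `b` contains `w` but not `α`.
  · have hba : ‖b - α‖ ≤ r / 2 + 2 * r := by
      have := norm_sub_le_norm_sub_add_norm_sub b w α
      rw [norm_sub_rev b w, he] at this
      linarith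
    have hsub : Metric.closedBall b r ⊆ Metric.ball α δ \ {α} := by
      intro y hy
      rw [mem_closedBall_iff_norm] at hy
      refine ⟨?_, ?_⟩
      · rw [mem_ball_iff_norm]
        have := norm_sub_le_norm_sub_add_norm_sub y b α
        linarith
      · rintro rfl
        have := norm_sub_le_norm_sub_add_norm_sub w b y
        rw [norm_sub_rev b y] at this
        linarith
    have hdiff : DifferentiableOn ℂ (fun y => f y * ((y - b) ^ 2 + r ^ 2 * (b * y)))
        (Metric.closedBall b r) := (hf.mono hsub).mul (by fun_prop)
    have hmax := Complex.norm_le_of_forall_mem_frontier_norm_le (C := 3 * M * r)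
      Metric.isBounded_ball
      (hdiff.diffContOnCl_ball subset_rfl) (fun y hy => ?_)
      (subset_closure (show w ∈ Metric.ball b r by rw [mem_ball_iff_norm, he]; linarith))
    · rw [norm_mul] at hmax
      have hQ : r ^ 2 / 2 ≤ ‖(w - b) ^ 2 + r ^ 2 * (b * w)‖ := by
        have h1 : ‖(r : ℂ) ^ 2 * (b * w)‖ = r ^ 2 * ‖w‖ := by
          rw [norm_mul, norm_mul, hbn, norm_pow, Complex.norm_real, Real.norm_of_nonneg hr0.le,
            one_mul]
        have h2 : ‖(w - b) ^ 2‖ ≤ (r / 2) ^ 2 := by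
          rw [norm_pow, he]
          exact pow_le_pow_left₀ (abs_nonneg _) hc.le 2
        have h3 := norm_sub_le_norm_add ((r : ℂ) ^ 2 * (b * w)) ((w - b) ^ 2)
        rw [add_comm, h1] at h3
        nlinarith
      have h5 := (mul_le_mul_of_nonneg_left hQ (norm_nonneg (f w))).trans hmax
      have h6 : ‖f w‖ * r ≤ 6 * M := by
        by_contra! hcon
        nlinarith
      have h7 : ‖w - α‖ = 2 * r := by linarith
      rw [h7]
      linarith
    · rw [frontier_ball b hr0.ne', mem_sphere_iff_norm] at hy
      rw [norm_mul, norm_sq_add_eq hbn hy]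
      by_cases hy1 : ‖y‖ = 1
      · rw [hy1]; simp; positivity
      · have h1 := hb y hy1
        have h2 : |‖y‖ ^ 2 - 1| = |‖y‖ - 1| * (‖y‖ + 1) := by
          rw [show ‖y‖ ^ 2 - 1 = (‖y‖ - 1) * (‖y‖ + 1) by ring, abs_mul,
            abs_of_nonneg (by positivity : 0 ≤ ‖y‖ + 1)]
        have h3 : ‖y‖ + 1 ≤ 3 := by
          have := norm_le_norm_add_norm_sub b y
          rw [hbn, norm_sub_rev, hy] at this
          linarith
        rw [h2]
        calc ‖f y‖ * (r * (|‖y‖ - 1| * (‖y‖ + 1)))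
            = ‖f y‖ * |‖y‖ - 1| * (‖y‖ + 1) * r := by ring
          _ ≤ M * 3 * r := by gcongr
          _ = _ := by ring

theorem summable_pow_smul {E : Type*} [NormedAddCommGroup E] [NormedSpace ℂ E] [CompleteSpace E]
    {b : ℕ → E} {M : ℝ} (hb : ∀ k, ‖b k‖ ≤ M) {w : ℂ} (hw : ‖w‖ < 1) :
    Summable fun k => w ^ k • b k := by
  refine Summable.of_norm_bounded ((summable_geometric_of_lt_one (norm_nonneg w) hw).mul_right M)
    fun k => ?_
  rw [norm_smul, norm_pow]
  exact mul_le_mul_of_nonneg_left (hb k) (by positivity)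

theorem summable_pow_mul {b : ℕ → ℂ} {M : ℝ} (hb : ∀ k, ‖b k‖ ≤ M) {w : ℂ} (hw : ‖w‖ < 1) :
    Summable fun k => w ^ k * b k :=
  summable_pow_smul hb hw

theorem norm_tsum_pow_mul_le {b : ℕ → ℂ} {M : ℝ} (hb : ∀ k, ‖b k‖ ≤ M) {w : ℂ} (hw : ‖w‖ < 1) :
    ‖∑' k, w ^ k * b k‖ * (1 - ‖w‖) ≤ M := by
  have h := tsum_of_norm_bounded ((hasSum_geometric_of_lt_one (norm_nonneg w) hw).mul_right M)
    (f := fun k => w ^ k * b k) fun k => by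
      rw [norm_mul, norm_pow]
      exact mul_le_mul_of_nonneg_left (hb k) (by positivity)
  have h1 : 0 < 1 - ‖w‖ := by linarith
  calc _ ≤ (1 - ‖w‖)⁻¹ * M * (1 - ‖w‖) := by gcongr
    _ = M := by field_simp

theorem differentiableOn_tsum_pow_mul {b : ℕ → ℂ} {M : ℝ} (hb : ∀ k, ‖b k‖ ≤ M) :
    DifferentiableOn ℂ (fun w : ℂ => ∑' k, w ^ k * b k) (Metric.ball 0 1) := by
  intro w hw
  rw [mem_ball_zero_iff] at hw
  obtain ⟨r, hr1, hr2⟩ := exists_between hw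
  have hr0 : 0 ≤ r := (norm_nonneg w).trans hr1.le
  have := Complex.differentiableOn_tsum_of_summable_norm (F := fun k (w : ℂ) => w ^ k * b k)
    (U := Metric.ball 0 r) ((summable_geometric_of_lt_one hr0 hr2).mul_right M)
    (fun k => by fun_prop) Metric.isOpen_ball fun k y hy => by
      rw [mem_ball_zero_iff] at hy
      rw [norm_mul, norm_pow]
      exact mul_le_mul (pow_le_pow_left₀ (norm_nonneg _) hy.le k) (hb k) (norm_nonneg _)
        (by positivity)
  exact (this.differentiableAt (Metric.isOpen_ball.mem_nhds (by simpa using hr1)))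
    |>.differentiableWithinAt

namespace CarlemanExtension

variable {F : Finset ℂ} {a : ℤ → ℂ} {f : ℂ → ℂ} {M : ℝ}

theorem norm_mul_le (h : CarlemanExtension F a f) (ha : ∀ k, ‖a k‖ ≤ M) (w : ℂ) (hw : ‖w‖ ≠ 1) :
    ‖f w‖ * |‖w‖ - 1| ≤ M := by
  rcases lt_or_gt_of_ne hw with hw | hw
  · rw [h.inside w hw, abs_sub_comm, abs_of_pos (by linarith)]
    exact norm_tsum_pow_mul_le (fun k => ha _) hw
  · have hw0 : 0 < ‖w‖ := by linarith
    have ht : ‖w⁻¹‖ < 1 := by rw [norm_inv]; exact inv_lt_one_of_one_lt₀ hw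
    rw [h.outside w hw, abs_of_pos (by linarith), norm_neg]
    simp_rw [pow_succ', mul_assoc]
    rw [tsum_mul_left, norm_mul]
    have := norm_tsum_pow_mul_le (b := fun k => a (k + 1)) (fun k => ha _) ht
    rw [norm_inv] at this ⊢
    calc _ = ‖∑' k : ℕ, w⁻¹ ^ k * a (k + 1)‖ * (1 - ‖w‖⁻¹) := by field_simp
      _ ≤ M := this

/-- Applying `shift - α` to a bounded sequence removes the singularity `α` of its Carleman
transform. -/
theorem erase (h : CarlemanExtension F a f) (ha : ∀ k, ‖a k‖ ≤ M) (hF : ∀ w ∈ F, ‖w‖ = 1) {α : ℂ}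
    (hα : α ∈ F) : ∃ g, CarlemanExtension (F.erase α) (fun k => a (k + 1) - α * a k) g := by
  have hα1 := hF α hα
  have hM : 0 ≤ M := (norm_nonneg _).trans (ha 0)
  set g₀ : ℂ → ℂ := fun w => (w - α) * f w + a 1 with hg₀
  have hs : ((F.erase α : Finset ℂ) : Set ℂ)ᶜ ∈ 𝓝 α :=
    (Finset.finite_toSet _).isClosed.isOpen_compl.mem_nhds (by simp)
  have hset : ((F.erase α : Finset ℂ) : Set ℂ)ᶜ \ {α} = (F : Set ℂ)ᶜ := by
    ext y
    simp only [Finset.coe_erase, Set.mem_sdiff, Set.mem_compl_iff, Set.mem_singleton_iff,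
      Finset.mem_coe, not_and, not_not]
    constructor
    · rintro ⟨h1, h2⟩ h3
      exact h2 (h1 h3)
    · intro h1
      exact ⟨fun h2 => absurd h2 h1, fun h2 => h1 (h2 ▸ hα)⟩
  obtain ⟨δ, hδ, hball⟩ := Metric.mem_nhds_iff.mp hs
  have hd : DifferentiableOn ℂ g₀ (((F.erase α : Finset ℂ) : Set ℂ)ᶜ \ {α}) := by
    rw [hset]
    exact ((by fun_prop : DifferentiableOn ℂ (fun w => w - α) _).mul h.differentiableOn).add_const _
  have hev := eventually_norm_mul_le hα1 hδ hM
    (h.differentiableOn.mono (hset ▸ Set.sdiff_subset_sdiff_left hball)) (h.norm_mul_le ha)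
  have hO : (fun w => g₀ w - g₀ α) =o[𝓝[≠] α] fun w => (w - α)⁻¹ := by
    apply IsBoundedUnder.isLittleO_sub_self_inv
    refine ⟨12 * M, ?_⟩
    rw [eventually_map]
    filter_upwards [hev] with w hw
    simpa [hg₀, mul_comm] using hw
  have hne : ∀ w : ℂ, ‖w‖ ≠ 1 → w ≠ α := fun w hw h => hw (h ▸ hα1)
  refine ⟨_, Complex.differentiableOn_update_limUnder_of_isLittleO hs hd hO, fun w hw => ?_,
    fun w hw => ?_⟩
  · rw [Function.update_of_ne (hne w hw.ne), hg₀]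
    simp only
    have h1 := summable_pow_mul (b := fun k : ℕ => a (-k)) (fun k => ha _) hw
    have h2 := summable_pow_mul (b := fun k : ℕ => a (-k + 1)) (fun k => ha _) hw
    simp_rw [mul_sub]
    rw [h2.tsum_sub (by simpa [mul_left_comm] using h1.mul_left α), h2.tsum_eq_zero_add,
      h.inside w hw]
    simp_rw [pow_succ', mul_left_comm _ α, mul_assoc, tsum_mul_left]
    push_cast
    simp only [neg_add_rev, neg_add_cancel_comm, pow_zero, one_mul]
    ring
  · rw [Function.update_of_ne (hne w hw.ne'), hg₀]
    simp only
    have hw0 : w ≠ 0 := norm_pos_iff.mp (by linarith)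
    have ht : ‖w⁻¹‖ < 1 := by rw [norm_inv]; exact inv_lt_one_of_one_lt₀ hw
    have h1 := summable_pow_mul (b := fun k : ℕ => a (k + 1)) (fun k => ha _) ht
    have h2 := summable_pow_mul (b := fun k : ℕ => a (k + 1 + 1)) (fun k => ha _) ht
    rw [h.outside w hw]
    simp_rw [mul_sub, pow_succ', mul_assoc]
    rw [(h2.mul_left w⁻¹).tsum_sub (by simpa [mul_left_comm] using (h1.mul_left α).mul_left w⁻¹)]
    simp_rw [mul_left_comm _ α, tsum_mul_left]
    have h3 := h1.tsum_eq_zero_add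
    simp_rw [pow_succ', mul_assoc, tsum_mul_left] at h3
    push_cast at h3 ⊢
    simp only [pow_zero, one_mul] at h3
    field_simp at h3 ⊢
    linear_combination -h3

theorem apply_zero_eq_zero (h : CarlemanExtension ∅ a f) (ha : ∀ k, ‖a k‖ ≤ M) : a 0 = 0 := by
  have hd : Differentiable ℂ f := by
    rw [← differentiableOn_univ]
    simpa using h.differentiableOn
  have ht : Tendsto f (cocompact ℂ) (𝓝 0) := by
    have h1 : Tendsto (fun w : ℂ => M / (‖w‖ - 1)) (cocompact ℂ) (𝓝 0) :=
      (tendsto_atTop_add_const_right _ (-1) (tendsto_norm_cocompact_atTop)).const_div_atTop M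
    refine squeeze_zero_norm' ?_ h1
    filter_upwards [tendsto_norm_cocompact_atTop.eventually_gt_atTop 1] with w hw
    have := h.norm_mul_le ha w hw.ne'
    rw [abs_of_pos (by linarith)] at this
    rwa [le_div_iff₀ (by linarith)]
  have h0 := hd.apply_eq_of_tendsto_cocompact 0 ht
  rw [h.inside 0 (by simp), tsum_eq_single 0 (by intro k hk; simp [hk])] at h0
  simpa using h0

end CarlemanExtension

/-! ### Bounded orbits of an operator -/

section Orbit

variable {D : Type*} [NormedAddCommGroup D] [NormedSpace ℂ D]

/-- A bounded two-sided orbit of `U` whose scalar Carleman transforms extend across the circle off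
`F` is annihilated by `∏_{α ∈ F} (U - α)`. -/
theorem aeval_prod_apply_eq_zero (U : D →L[ℂ] D) (F : Finset ℂ) (hF : ∀ w ∈ F, ‖w‖ = 1)
    (T : ℤ → D) (hT : ∀ k, U (T k) = T (k + 1)) (M : ℝ) (hM : ∀ k, ‖T k‖ ≤ M)
    (hC : ∀ l : D →L[ℂ] ℂ, ∃ f, CarlemanExtension F (fun k => l (T k)) f) :
    Polynomial.aeval U (∏ α ∈ F, (Polynomial.X - Polynomial.C α)) (T 0) = 0 := by
  classical
  induction F using Finset.induction_on generalizing T M with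
  | empty =>
    simp only [Finset.prod_empty, map_one, one_apply_eq_self]
    refine SeparatingDual.eq_zero_of_forall_dual_eq_zero (R := ℂ) fun l => ?_
    obtain ⟨f, hf⟩ := hC l
    exact hf.apply_zero_eq_zero (M := ‖l‖ * M) fun k =>
      (l.le_opNorm _).trans (mul_le_mul_of_nonneg_left (hM k) (norm_nonneg l))
  | insert α F hα ih =>
    rw [Finset.prod_insert hα, mul_comm, map_mul, mul_apply_eq_comp]
    have e : ∀ k, Polynomial.aeval U (Polynomial.X - Polynomial.C α) (T k) = T (k + 1) - α • T k :=
      fun k => by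
        simp [hT, Algebra.algebraMap_eq_smul_one]
    rw [e]
    refine ih (fun w hw => hF w (Finset.mem_insert_of_mem hw)) (fun k => T (k + 1) - α • T k)
      (fun k => by simp [hT]) (M + ‖α‖ * M) (fun k => (norm_sub_le _ _).trans ?_) fun l => ?_
    · rw [norm_smul]
      exact add_le_add (hM _) (mul_le_mul_of_nonneg_left (hM k) (norm_nonneg _))
    · obtain ⟨f, hf⟩ := hC l
      have := hf.erase (M := ‖l‖ * M) (fun k =>
        (l.le_opNorm _).trans (mul_le_mul_of_nonneg_left (hM k) (norm_nonneg l))) hF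
        (Finset.mem_insert_self α F)
      simpa [Finset.erase_insert hα] using this

/-- For `w` off the unit circle, the vector-valued Carleman transform of an orbit of `U` solves
`(U - w) X = T 1`; this is what makes the resolvent of `U` an analytic continuation of it. -/
theorem exists_carlemanExtension [CompleteSpace D] (U : D →L[ℂ] D) (F : Finset ℂ)
    (hU : ∀ w : ℂ, ‖w‖ = 1 → w ∉ F → IsUnit (U - algebraMap ℂ (D →L[ℂ] D) w))
    (T : ℤ → D) (hT : ∀ k, U (T k) = T (k + 1)) (M : ℝ) (hM : ∀ k, ‖T k‖ ≤ M) (l : D →L[ℂ] ℂ) :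
    ∃ f, CarlemanExtension F (fun k => l (T k)) f := by
  have hlM : ∀ k, ‖l (T k)‖ ≤ ‖l‖ * M := fun k =>
    (l.le_opNorm _).trans (mul_le_mul_of_nonneg_left (hM k) (norm_nonneg l))
  set fi : ℂ → ℂ := fun w => ∑' k : ℕ, w ^ k * l (T (-k)) with hfi
  set fo : ℂ → ℂ := fun w => -∑' k : ℕ, w⁻¹ ^ (k + 1) * l (T (k + 1)) with hfo
  set fr : ℂ → ℂ := fun w => l (-(resolvent U w) (T 1)) with hfr
  have hinv : ∀ w : ℂ, w ∈ resolventSet ℂ U → ∀ X : D, U X = T 1 + w • X → l X = fr w := by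
    intro w hw X hX
    have h1 : resolvent U w * (algebraMap ℂ (D →L[ℂ] D) w - U) = 1 :=
      Ring.inverse_mul_cancel _ hw
    have h2 : (algebraMap ℂ (D →L[ℂ] D) w - U) X = -T 1 := by
      rw [sub_apply, hX, Algebra.algebraMap_eq_smul_one]
      simp
    have h3 := congrArg (fun A : D →L[ℂ] D => A X) h1
    simp only [mul_apply_eq_comp, one_apply_eq_self, h2, map_neg] at h3
    rw [hfr, ← h3]
  have hin : ∀ w : ℂ, w ∈ resolventSet ℂ U → ‖w‖ < 1 → fi w = fr w := by
    intro w hw hw1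
    have hs := summable_pow_smul (b := fun k : ℕ => T (-k)) (fun k => hM _) hw1
    rw [← hinv w hw (∑' k : ℕ, w ^ k • T (-k)), l.map_tsum hs]
    · simp [hfi]
    · have hs' := summable_pow_smul (b := fun k : ℕ => T (-k + 1)) (fun k => hM _) hw1
      rw [U.map_tsum hs]
      simp only [map_smul, hT]
      rw [hs'.tsum_eq_zero_add]
      simp_rw [pow_succ', mul_smul]
      rw [tsum_const_smul'']
      simp
  have hout : ∀ w : ℂ, w ∈ resolventSet ℂ U → 1 < ‖w‖ → fo w = fr w := by
    intro w hw hw1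
    have hw0 : w ≠ 0 := norm_pos_iff.mp (by linarith)
    have ht : ‖w⁻¹‖ < 1 := by rw [norm_inv]; exact inv_lt_one_of_one_lt₀ hw1
    have hs := summable_pow_smul (b := fun k : ℕ => T (k + 1)) (fun k => hM _) ht
    have hs' := summable_pow_smul (b := fun k : ℕ => T (k + 1 + 1)) (fun k => hM _) ht
    rw [← hinv w hw (-(w⁻¹ • ∑' k : ℕ, w⁻¹ ^ k • T (k + 1))), map_neg, map_smul, l.map_tsum hs]
    · simp [hfo, pow_succ', mul_assoc, tsum_mul_left]
    · rw [map_neg, map_smul, U.map_tsum hs]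
      simp only [map_smul, hT, smul_neg, smul_smul, mul_inv_cancel₀ hw0, one_smul]
      rw [hs.tsum_eq_zero_add]
      simp_rw [pow_succ', mul_smul]
      rw [tsum_const_smul'']
      simp
  have hres : ∀ w : ℂ, ‖w‖ = 1 → w ∉ F → w ∈ resolventSet ℂ U := by
    intro w hw hwF
    rw [spectrum.mem_resolventSet_iff, ← neg_sub]
    exact (hU w hw hwF).neg
  classical
  refine ⟨fun w => if ‖w‖ < 1 then fi w else if 1 < ‖w‖ then fo w else fr w, ?_, ?_, ?_⟩
  · intro w hw
    refine DifferentiableAt.differentiableWithinAt ?_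
    rcases lt_trichotomy ‖w‖ 1 with h1 | h1 | h1
    · have : DifferentiableAt ℂ fi w :=
        (differentiableOn_tsum_pow_mul (b := fun k : ℕ => l (T (-k))) (fun k => hlM _))
          |>.differentiableAt (Metric.isOpen_ball.mem_nhds (by simpa using h1))
      refine this.congr_of_eventuallyEq ?_
      filter_upwards [continuous_norm.continuousAt.eventually_lt_const h1] with y hy
      simp [hy]
    · have hw' := hres w h1 (by simpa using hw)
      have : DifferentiableAt ℂ fr w := by
        have h2 := (spectrum.hasDerivAt_resolvent_const_left hw').differentiableAt
        have h3 : DifferentiableAt ℂ (fun w => resolvent U w (T 1)) w :=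
          h2.clm_apply (differentiableAt_const _)
        exact l.differentiableAt.comp w h3.neg
      refine this.congr_of_eventuallyEq ?_
      filter_upwards [(spectrum.isOpen_resolventSet U).mem_nhds hw'] with y hy
      split_ifs with h4 h5
      · exact hin y hy h4
      · exact hout y hy h5
      · rfl
    · have hw0 : w ≠ 0 := norm_pos_iff.mp (by linarith)
      have ht : ‖w⁻¹‖ < 1 := by rw [norm_inv]; exact inv_lt_one_of_one_lt₀ h1
      have : DifferentiableAt ℂ fo w := by
        have h2 := (differentiableOn_tsum_pow_mul (b := fun k : ℕ => l (T (k + 1)))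
          (fun k => hlM _)).differentiableAt (Metric.isOpen_ball.mem_nhds (mem_ball_zero_iff.mpr ht))
        have h3 : fo = fun w => -(w⁻¹ * ∑' k : ℕ, w⁻¹ ^ k * l (T (k + 1))) := by
          funext y
          simp [hfo, pow_succ', mul_assoc, tsum_mul_left]
        rw [h3]
        exact ((differentiableAt_inv hw0).mul (h2.comp w (differentiableAt_inv hw0))).neg
      refine this.congr_of_eventuallyEq ?_
      filter_upwards [continuous_norm.continuousAt.eventually_const_lt h1] with y hy
      simp [hy, hy.le]
  · intro w hw
    simp [hw, hfi]
  · intro w hw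
    simp [hw, hw.le, hfo]

end Orbit

/-! ### Sums over spheres in a homogeneous tree -/

section Sphere

variable {V : Type*} (G : SimpleGraph V) [G.LocallyFinite]

open Classical in
/-- The sphere of radius `n` about `x` as a finite set (see `mem_sphere`); the recursion makes its
finiteness evident. -/
def sphere (x : V) : ℕ → Finset V
  | 0 => {x}
  | n + 1 => ((sphere x n).biUnion fun y => G.neighborFinset y).filter fun y => G.dist x y = n + 1

variable {G}

theorem mem_sphere (hG : G.IsTree) {x y : V} {n : ℕ} : y ∈ sphere G x n ↔ G.dist x y = n := by
  classical
  induction n generalizing y with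
  | zero => rw [sphere, Finset.mem_singleton, hG.connected.dist_eq_zero_iff, eq_comm]
  | succ n ih =>
    rw [sphere, Finset.mem_filter, Finset.mem_biUnion, and_iff_right_iff_imp]
    intro h
    obtain ⟨z, hz, hzn, -⟩ := exists_parent hG x h
    exact ⟨z, ih.mpr hzn, by simpa [SimpleGraph.adj_comm] using hz⟩

variable (G) in
/-- The operator of summation over spheres of radius `n`, that is, convolution with the indicator
function of the sphere. -/
def sphereSum (K : Type*) [CommRing K] (n : ℕ) : Module.End K (V → K) where
  toFun f x := ∑ y ∈ sphere G x n, f y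
  map_add' f g := by funext x; simp [Finset.sum_add_distrib]
  map_smul' c f := by funext x; simp [Finset.mul_sum]

theorem sphereSum_apply {K : Type*} [CommRing K] (n : ℕ) (f : V → K) (x : V) :
    sphereSum G K n f x = ∑ y ∈ sphere G x n, f y := rfl

theorem sphere_one (hG : G.IsTree) (x : V) : sphere G x 1 = G.neighborFinset x := by
  ext y
  rw [mem_sphere hG, SimpleGraph.dist_eq_one_iff_adj, SimpleGraph.mem_neighborFinset]

theorem card_filter_neighborFinset (hG : G.IsTree) {q : ℕ} (hreg : G.IsRegularOfDegree (q + 1))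
    (z : V) (n : ℕ) {x : V} {d : ℕ} (hx : G.dist z x = d + 1) :
    ((G.neighborFinset x).filter fun y => G.dist z y = n).card =
      (if d = n then 1 else 0) + q * (if d + 2 = n then 1 else 0) := by
  have h := sum_neighbors hG hreg z (fun i => if i = n then 1 else 0) hx
  rw [Finset.sum_boole] at h
  exact_mod_cast h

theorem card_filter_neighborFinset_self {q : ℕ} (hreg : G.IsRegularOfDegree (q + 1))
    (z : V) (n : ℕ) :
    ((G.neighborFinset z).filter fun y => G.dist z y = n).card =
      (q + 1) * (if 1 = n then 1 else 0) := by
  have h := sum_neighbors_zero hreg z (fun i => if i = n then 1 else 0)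
  rw [Finset.sum_boole] at h
  exact_mod_cast h

theorem sphereSum_one_mul (hG : G.IsTree) {q : ℕ} (hreg : G.IsRegularOfDegree (q + 1))
    {K : Type*} [CommRing K] (n : ℕ) (f : V → K) :
    sphereSum G K 1 (sphereSum G K (n + 1) f) = sphereSum G K (n + 2) f +
      ((if n = 0 then q + 1 else q : ℕ) : K) • sphereSum G K n f := by
  classical
  funext x
  simp only [Pi.add_apply, Pi.smul_apply, smul_eq_mul, sphereSum_apply, sphere_one hG]
  rw [Finset.sum_comm' (t' := sphere G x (n + 2) ∪ sphere G x n)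
    (s' := fun z => (G.neighborFinset x).filter fun y => G.dist z y = n + 1)]
  · rw [Finset.sum_union]
    · congr 1
      · refine Finset.sum_congr rfl fun z hz => ?_
        rw [mem_sphere hG, SimpleGraph.dist_comm] at hz
        rw [Finset.sum_const, card_filter_neighborFinset hG hreg z (n + 1) hz]
        simp
      · rw [Finset.mul_sum]
        refine Finset.sum_congr rfl fun z hz => ?_
        rw [mem_sphere hG, SimpleGraph.dist_comm] at hz
        rw [Finset.sum_const, nsmul_eq_mul]
        congr 2
        rcases n with _ | n
        · rw [hG.connected.dist_eq_zero_iff] at hz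
          subst hz
          rw [card_filter_neighborFinset_self hreg]
          simp
        · rw [card_filter_neighborFinset hG hreg z _ hz]
          simp [show n ≠ n + 1 + 1 by omega]
    · rw [Finset.disjoint_left]
      intro z h1 h2
      rw [mem_sphere hG] at h1 h2
      omega
  · intro y z
    rw [Finset.mem_union, mem_sphere hG, mem_sphere hG, mem_sphere hG, Finset.mem_filter,
      SimpleGraph.dist_comm (u := y), SimpleGraph.dist_comm (u := x)]
    constructor
    · rintro ⟨h1, h2⟩
      refine ⟨⟨h1, h2⟩, ?_⟩
      rcases hG.dist_eq_dist_add_one_of_adj z (by simpa using h1) with h | h <;> omega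
    · rintro ⟨h, -⟩
      exact h

theorem sphereSum_zero (K : Type*) [CommRing K] : sphereSum G K 0 = 1 := by
  refine LinearMap.ext fun f => funext fun x => ?_
  simp [sphereSum_apply, sphere]

theorem heckeSeq_sphereSum (hG : G.IsTree) {q : ℕ} (hreg : G.IsRegularOfDegree (q + 1))
    (K : Type*) [CommRing K] : HeckeSeq q (sphereSum G K) where
  zero := sphereSum_zero K
  one := by
    refine LinearMap.ext fun f => ?_
    rw [Module.End.mul_apply, sphereSum_one_mul hG hreg 0, sphereSum_zero]
    funext x
    simp
    ring
  step n := by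
    refine LinearMap.ext fun f => ?_
    rw [Module.End.mul_apply, sphereSum_one_mul hG hreg (n + 1)]
    funext x
    simp

/-- An eigenfunction of the neighbour sum, evaluated at a point, turns the sphere operators into a
scalar Hecke sequence. -/
theorem heckeSeq_apply_of_eigen (hG : G.IsTree) {q : ℕ} (hreg : G.IsRegularOfDegree (q + 1))
    {f : V → ℂ} {o : V} {β : ℂ} (ho : f o = 1) (hf : sphereSum G ℂ 1 f = β • f) :
    HeckeSeq q (fun n => sphereSum G ℂ n f o) ∧ sphereSum G ℂ 1 f o = β := by
  have hH := heckeSeq_sphereSum hG hreg ℂ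
  have h1 : sphereSum G ℂ 1 f o = β := by simp [hf, ho]
  have hc : ∀ n, (sphereSum G ℂ 1 * sphereSum G ℂ n) f o = β * sphereSum G ℂ n f o := by
    intro n
    rw [(hH.commute_one n).eq, Module.End.mul_apply, hf]
    simp
  refine ⟨⟨by simp [hH.zero, ho], ?_, fun n => ?_⟩, h1⟩
  · have h2 := hc 1
    rw [hH.one] at h2
    rw [h1]
    simpa [ho, h1] using h2.symm
  · rw [h1, ← hc, hH.step]
    simp

theorem sphereSum_mono {f g : V → ℝ} (h : f ≤ g) (n : ℕ) :
    sphereSum G ℝ n f ≤ sphereSum G ℝ n g :=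
  fun _ => Finset.sum_le_sum fun y _ => h y

/-- If `ψ ≥ 0` satisfies `∑_{y ~ x} ψ(y) ≤ (v + w) ψ(x)` with `v w = q`, then its sums over spheres
grow like powers of `v`: the differences `Lₙ₊₂ ψ - w Lₙ₊₁ ψ` grow at most geometrically. -/
theorem sphereSum_le (hG : G.IsTree) {q : ℕ} (hreg : G.IsRegularOfDegree (q + 1)) {ψ : V → ℝ}
    {v w : ℝ} (hψ : 0 ≤ ψ) (hv : 1 ≤ v) (hw : 0 ≤ w) (hwv : w ≤ v) (hvw : v * w = q)
    (h : sphereSum G ℝ 1 ψ ≤ (v + w) • ψ) (n : ℕ) (x : V) :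
    sphereSum G ℝ n ψ x ≤ (1 + n) * v ^ n * ψ x := by
  have hH := heckeSeq_sphereSum hG hreg ℝ
  have hmono : ∀ n x, sphereSum G ℝ 1 (sphereSum G ℝ n ψ) x ≤ (v + w) * sphereSum G ℝ n ψ x := by
    intro n x
    rw [← Module.End.mul_apply, (hH.commute_one n).eq, Module.End.mul_apply]
    refine (sphereSum_mono h n x).trans (le_of_eq ?_)
    simp
  have hdiff : ∀ n x, sphereSum G ℝ (n + 2) ψ x - w * sphereSum G ℝ (n + 1) ψ x ≤
      v ^ (n + 2) * ψ x := by
    intro n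
    induction n with
    | zero =>
      intro x
      have h1 := sphereSum_one_mul hG hreg 0 ψ
      have h2 := congrFun h1 x
      have h3 := hmono 1 x
      have h4 := h x
      rw [zero_add] at h2
      rw [h2, sphereSum_zero] at h3
      simp only [if_true, Pi.add_apply, Pi.smul_apply, smul_eq_mul, Module.End.one_apply,
        Nat.cast_add, Nat.cast_one, ← hvw] at h3 h4
      have h5 := mul_le_mul_of_nonneg_left h4 (by linarith : 0 ≤ v)
      have := hψ x
      simp only [Pi.zero_apply] at this
      simp only [zero_add]
      nlinarith
    | succ n ih =>
      intro x
      have h1 := sphereSum_one_mul hG hreg (n + 1) ψ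
      have h2 := congrFun h1 x
      have h3 := hmono (n + 2) x
      rw [show n + 1 + 1 = n + 2 from rfl, show n + 1 + 2 = n + 3 from rfl] at h2
      rw [h2] at h3
      simp only [Nat.add_eq_zero_iff, one_ne_zero, and_false, if_false, Pi.add_apply,
        Pi.smul_apply, smul_eq_mul, ← hvw] at h3
      have h4 := mul_le_mul_of_nonneg_left (ih x) (by linarith : 0 ≤ v)
      rw [show n + 1 + 2 = n + 3 from rfl, show n + 1 + 1 = n + 2 from rfl, pow_succ' v (n + 2)]
      nlinarith
  have key : ∀ n : ℕ, sphereSum G ℝ (n + 1) ψ x ≤ (1 + (n + 1)) * v ^ (n + 1) * ψ x := by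
    have hψx : 0 ≤ ψ x := hψ x
    intro n
    induction n with
    | zero =>
      have h4 := h x
      simp only [Pi.smul_apply, smul_eq_mul] at h4
      rw [zero_add, pow_one]
      push_cast
      nlinarith
    | succ n ih =>
      have h1 := hdiff n x
      have h2 := mul_le_mul_of_nonneg_left ih hw
      have h3 : w * ((1 + (n + 1)) * v ^ (n + 1) * ψ x) ≤
          v * ((1 + (n + 1)) * v ^ (n + 1) * ψ x) := by gcongr
      have h4 : v * ((1 + (n + 1)) * v ^ (n + 1) * ψ x) + v ^ (n + 2) * ψ x =
        (1 + ((n : ℝ) + 1 + 1)) * v ^ (n + 2) * ψ x := by ring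
      rw [show n + 1 + 1 = n + 2 from rfl]
      push_cast
      linarith
  rcases n with _ | n
  · simp [sphereSum_zero]
  · exact_mod_cast key n

theorem hasSum_sphere {E : Type*} [NormedAddCommGroup E] [CompleteSpace E] (hG : G.IsTree) (x : V) {f : V → E}
    (hf : Summable f) : HasSum (fun n => ∑ y ∈ sphere G x n, f y) (∑' y, f y) := by
  have h := hf.hasSum.tsum_fiberwise (G.dist x)
  convert h using 2 with n
  have : G.dist x ⁻¹' {n} = (sphere G x n : Set V) := by
    ext y
    simp [mem_sphere hG]
  rw [this, Finset.tsum_subtype']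

theorem summable_of_sphere_le (hG : G.IsTree) (x : V) {f : V → ℂ} {b : ℕ → ℝ} (hb : Summable b)
    (hf : ∀ n, ∑ y ∈ sphere G x n, ‖f y‖ ≤ b n) : Summable f := by
  classical
  have hb0 : ∀ n, 0 ≤ b n := fun n => (Finset.sum_nonneg fun _ _ => norm_nonneg _).trans (hf n)
  refine Summable.of_norm (summable_of_sum_le (c := ∑' n, b n) (fun _ => norm_nonneg _) fun u => ?_)
  rw [← Finset.sum_fiberwise_of_maps_to (t := u.image (G.dist x))
    (fun y hy => Finset.mem_image_of_mem _ hy)]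
  refine le_trans (Finset.sum_le_sum fun n _ => ?_) (hb.sum_le_tsum _ fun n _ => hb0 n)
  refine le_trans (Finset.sum_le_sum_of_subset_of_nonneg ?_ fun _ _ _ => norm_nonneg _) (hf n)
  intro y hy
  rw [mem_sphere hG]
  exact (Finset.mem_filter.mp hy).2

theorem exists_dist_eq (hG : G.IsTree) {q : ℕ} (hq : 1 ≤ q) (hreg : G.IsRegularOfDegree (q + 1))
    (o : V) (n : ℕ) : ∃ x, G.dist o x = n := by
  classical
  have hcard : ∀ x, (G.neighborFinset x).card = q + 1 := fun x => by
    rw [SimpleGraph.card_neighborFinset_eq_degree, hreg x]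
  have key : ∀ n, ∃ x, G.dist o x = n + 1 := by
    intro n
    induction n with
    | zero =>
      obtain ⟨y, hy⟩ := Finset.card_pos.mp (by rw [hcard o]; omega)
      exact ⟨y, SimpleGraph.dist_eq_one_iff_adj.mpr (by simpa using hy)⟩
    | succ n ih =>
      obtain ⟨x, hx⟩ := ih
      obtain ⟨y, -, -, hr⟩ := exists_parent hG o hx
      obtain ⟨w, hw, hwy⟩ := Finset.exists_mem_ne (s := G.neighborFinset x)
        (by rw [hcard x]; omega) y
      exact ⟨w, hr w hw hwy⟩
  rcases n with _ | n
  · exact ⟨o, by simp⟩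
  · exact key n

end Sphere

/-! ### Sphere operators on the Schwartz space -/

section Weighted

variable {V : Type*} {G : SimpleGraph V} {o : V} {q : ℕ} {p : ℝ}

theorem weighted_eq (m : ℕ) (φ : V → ℂ) (x : V) : weighted G o q p m φ x =
    (1 + (G.dist o x : ℝ)) ^ m * ((q : ℝ) ^ (1 / p)) ^ G.dist o x * ‖φ x‖ := by
  rw [weighted, ← Real.rpow_natCast ((q : ℝ) ^ (1 / p)), ← Real.rpow_mul (Nat.cast_nonneg q)]
  congr 3
  ring

theorem weighted_nonneg (m : ℕ) (φ : V → ℂ) (x : V) : 0 ≤ weighted G o q p m φ x := by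
  unfold weighted
  positivity

theorem nu_nonneg (m : ℕ) (φ : V → ℂ) : 0 ≤ nu G o q p m φ :=
  Real.iSup_nonneg (weighted_nonneg m φ)

theorem weighted_le_nu {φ : V → ℂ} (hφ : φ ∈ Schwartz G o q p) (m : ℕ) (x : V) :
    weighted G o q p m φ x ≤ nu G o q p m φ :=
  le_ciSup (hφ m) x

/-- The function `q^(-|x| / p)` satisfies the hypothesis of `sphereSum_le` with `v = q^(1 / p)`: it is
an eigenfunction away from `o`, with the inequality in the right direction at `o`. -/
theorem sphereSum_rpow_le [G.LocallyFinite] (hq : 2 ≤ q) (hG : G.IsTree)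
    (hreg : G.IsRegularOfDegree (q + 1)) (hp1 : 1 ≤ p) (hp2 : p < 2) (n : ℕ) (x : V) :
    ∑ y ∈ sphere G x n, ((q : ℝ) ^ (1 / p))⁻¹ ^ G.dist o y ≤
      (1 + n) * ((q : ℝ) ^ (1 / p)) ^ n * ((q : ℝ) ^ (1 / p))⁻¹ ^ G.dist o x := by
  have hq1 : (1 : ℝ) < q := by exact_mod_cast (by omega : 1 < q)
  set v := (q : ℝ) ^ (1 / p) with hv
  have hv1 : 1 ≤ v := Real.one_le_rpow hq1.le (by positivity)
  have hv0 : 0 < v := by linarith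
  have hvq : (q : ℝ) ≤ v * v := by
    rw [hv, ← Real.rpow_add (by linarith)]
    conv_lhs => rw [← Real.rpow_one (q : ℝ)]
    refine Real.rpow_le_rpow_of_exponent_le hq1.le ?_
    have : 1 / 2 < 1 / p := one_div_lt_one_div_of_lt (by linarith) hp2
    linarith
  refine sphereSum_le hG hreg (ψ := fun y => v⁻¹ ^ G.dist o y) (v := v) (w := q / v)
    (fun y => by positivity) hv1 (by positivity) ?_ (by field_simp) ?_ n x
  · rwa [div_le_iff₀ hv0]
  · intro y
    simp only [Pi.smul_apply, smul_eq_mul, sphereSum_apply, sphere_one hG]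
    rcases hd : G.dist o y with _ | d
    · obtain rfl := hG.connected.dist_eq_zero_iff.mp hd
      have h := sum_neighbors_zero hreg o fun i => ((v⁻¹ : ℝ) : ℂ) ^ i
      have h' : ∑ y ∈ G.neighborFinset o, v⁻¹ ^ G.dist o y = ((q : ℝ) + 1) * v⁻¹ ^ 1 := by
        exact_mod_cast h
      rw [h', pow_zero, mul_one, pow_one, add_mul, one_mul, div_eq_mul_inv]
      have : v⁻¹ ≤ 1 := inv_le_one_of_one_le₀ hv1
      linarith
    · have h := sum_neighbors hG hreg o (fun i => ((v⁻¹ : ℝ) : ℂ) ^ i) hd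
      have h' : ∑ y ∈ G.neighborFinset y, v⁻¹ ^ G.dist o y = v⁻¹ ^ d + q * v⁻¹ ^ (d + 2) := by
        exact_mod_cast h
      rw [h']
      refine le_of_eq ?_
      have : v * v⁻¹ = 1 := mul_inv_cancel₀ hv0.ne'
      rw [div_eq_mul_inv]
      linear_combination -(v⁻¹ ^ d) * this

/-- Summation over spheres of radius `n` has norm at most `(1 + n)^(m + 1) q^(n / p)` for the
seminorm `ν_{p,m}`. -/
theorem weighted_sphereSum_le [G.LocallyFinite] (hq : 2 ≤ q) (hG : G.IsTree)
    (hreg : G.IsRegularOfDegree (q + 1)) (hp1 : 1 ≤ p) (hp2 : p < 2) {φ : V → ℂ}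
    (hφ : φ ∈ Schwartz G o q p) (m n : ℕ) (x : V) :
    weighted G o q p m (sphereSum G ℂ n φ) x ≤
      (1 + n) ^ (m + 1) * ((q : ℝ) ^ (1 / p)) ^ n * nu G o q p m φ := by
  have hS := sphereSum_rpow_le (o := o) hq hG hreg hp1 hp2 n x
  have hν := weighted_le_nu hφ m
  have hν0 := nu_nonneg (G := G) (o := o) (q := q) (p := p) m φ
  have hq1 : (1 : ℝ) < q := by exact_mod_cast (by omega : 1 < q)
  rw [weighted_eq]
  simp_rw [weighted_eq] at hν
  set v := (q : ℝ) ^ (1 / p) with hv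
  set N := nu G o q p m φ
  have hv0 : 0 < v := by positivity
  have h1 : ∀ y ∈ sphere G x n, (1 + (G.dist o x : ℝ)) ^ m * ‖φ y‖ ≤
      (1 + n) ^ m * N * v⁻¹ ^ G.dist o y := by
    intro y hy
    rw [mem_sphere hG] at hy
    have h2 : G.dist o x ≤ G.dist o y + n := by
      have := hG.connected.dist_triangle (u := o) (v := y) (w := x)
      rwa [SimpleGraph.dist_comm (u := y), hy] at this
    have h3 : 1 + (G.dist o x : ℝ) ≤ (1 + n) * (1 + G.dist o y) := by
      have : (G.dist o x : ℝ) ≤ G.dist o y + n := by exact_mod_cast h2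
      have : (0 : ℝ) ≤ n * G.dist o y := by positivity
      nlinarith
    calc (1 + (G.dist o x : ℝ)) ^ m * ‖φ y‖
        ≤ ((1 + n) * (1 + G.dist o y)) ^ m * ‖φ y‖ := by gcongr
      _ = (1 + n) ^ m * ((1 + (G.dist o y : ℝ)) ^ m * v ^ G.dist o y * ‖φ y‖) *
          v⁻¹ ^ G.dist o y := by
        rw [inv_pow, mul_pow]
        field_simp
      _ ≤ _ := by gcongr; exact hν y
  have h2 : (1 + (G.dist o x : ℝ)) ^ m * ‖sphereSum G ℂ n φ x‖ ≤
      (1 + n) ^ m * N * ((1 + n) * v ^ n * v⁻¹ ^ G.dist o x) := by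
    calc (1 + (G.dist o x : ℝ)) ^ m * ‖sphereSum G ℂ n φ x‖
        ≤ (1 + (G.dist o x : ℝ)) ^ m * ∑ y ∈ sphere G x n, ‖φ y‖ := by
          gcongr
          exact norm_sum_le _ _
      _ ≤ ∑ y ∈ sphere G x n, (1 + n) ^ m * N * v⁻¹ ^ G.dist o y := by
          rw [Finset.mul_sum]
          exact Finset.sum_le_sum h1
      _ ≤ _ := by
          rw [← Finset.mul_sum]
          gcongr
  calc _ = v ^ G.dist o x * ((1 + (G.dist o x : ℝ)) ^ m * ‖sphereSum G ℂ n φ x‖) := by ring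
    _ ≤ v ^ G.dist o x * ((1 + n) ^ m * N * ((1 + n) * v ^ n * v⁻¹ ^ G.dist o x)) := by gcongr
    _ = _ := by
      rw [inv_pow]
      field_simp
      ring

theorem sphereSum_mem [G.LocallyFinite] (hq : 2 ≤ q) (hG : G.IsTree)
    (hreg : G.IsRegularOfDegree (q + 1)) (hp1 : 1 ≤ p) (hp2 : p < 2) {φ : V → ℂ}
    (hφ : φ ∈ Schwartz G o q p) (n : ℕ) : sphereSum G ℂ n φ ∈ Schwartz G o q p := fun m =>
  ⟨_, Set.forall_mem_range.mpr fun x => weighted_sphereSum_le hq hG hreg hp1 hp2 hφ m n x⟩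

theorem single_mem [DecidableEq V] : (Pi.single o 1 : V → ℂ) ∈ Schwartz G o q p := by
  intro m
  refine ⟨1, Set.forall_mem_range.mpr fun x => ?_⟩
  by_cases hx : x = o
  · subst hx
    simp [weighted]
  · simp [weighted, hx]

/-- The convolution kernel of a multiplier is rapidly decreasing, being the image of the point mass
at the reference vertex. -/
theorem Multiplier.exists_norm_le [G.LocallyFinite] (hq : 2 ≤ q) (hG : G.IsTree)
    (hreg : G.IsRegularOfDegree (q + 1)) (Λ : Multiplier G o q p) (m : ℕ) :
    ∃ K : ℝ, ∀ n : ℕ, (1 + n) ^ m * ((q : ℝ) ^ (1 / p)) ^ n * ‖Λ.k n‖ ≤ K := by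
  classical
  obtain ⟨K, hK⟩ := Λ.mem' _ single_mem m
  refine ⟨K, fun n => ?_⟩
  obtain ⟨x, hx⟩ := exists_dist_eq hG (by omega) hreg o n
  have h := hK ⟨x, rfl⟩
  rw [weighted_eq, hx, conv, tsum_eq_single o (by intro y hy; simp [hy])] at h
  simpa [SimpleGraph.dist_comm (u := x), hx] using h

theorem Multiplier.exists_summable [G.LocallyFinite] (hq : 2 ≤ q) (hG : G.IsTree)
    (hreg : G.IsRegularOfDegree (q + 1)) (Λ : Multiplier G o q p) (m : ℕ) :
    Summable fun n : ℕ => ‖Λ.k n‖ * ((1 + n) ^ m * ((q : ℝ) ^ (1 / p)) ^ n) := by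
  obtain ⟨K, hK⟩ := Λ.exists_norm_le hq hG hreg (m + 2)
  have hs : Summable fun n : ℕ => K * (1 / ((n : ℝ) + 1) ^ 2) :=
    ((summable_nat_add_iff 1).mpr (Real.summable_one_div_nat_pow.mpr one_lt_two) |>.congr
      (by intro n; push_cast; rfl)).mul_left K
  refine Summable.of_nonneg_of_le (fun n => by positivity) (fun n => ?_) hs
  have h := hK n
  rw [mul_one_div, le_div_iff₀ (by positivity)]
  refine le_trans (le_of_eq ?_) h
  ring

end Weighted

/-! ### The Schwartz space with one seminorm -/

section OrderSpace

variable {V : Type*} {G : SimpleGraph V} {o : V} {q : ℕ} {p : ℝ} {m : ℕ}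

theorem nu_le {φ : V → ℂ} {C : ℝ} (hC : 0 ≤ C) (h : ∀ x, weighted G o q p m φ x ≤ C) :
    nu G o q p m φ ≤ C :=
  Real.iSup_le h hC

theorem nu_smul (m : ℕ) (c : ℂ) (φ : V → ℂ) :
    nu G o q p m (c • φ) = ‖c‖ * nu G o q p m φ := by
  rw [nu, nu, Real.mul_iSup_of_nonneg (norm_nonneg c)]
  congr 1
  funext x
  simp only [weighted, Pi.smul_apply, smul_eq_mul, norm_mul]
  ring

variable (G o q p m) in
/-- The seminorm `ν_{p,m}` on the Schwartz space. -/
def nuSeminorm : Seminorm ℂ (Schwartz G o q p) :=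
  Seminorm.of (fun φ => nu G o q p m φ)
    (fun φ ψ => by
      refine nu_le (add_nonneg (nu_nonneg _ _) (nu_nonneg _ _)) fun x => ?_
      refine le_trans ?_ (add_le_add (weighted_le_nu φ.2 m x) (weighted_le_nu ψ.2 m x))
      unfold weighted
      rw [← mul_add]
      gcongr
      exact norm_add_le _ _)
    (fun c φ => nu_smul m c (φ : V → ℂ))

/-- A copy of the Schwartz space carrying the single seminorm `ν_{p,m}`. Its dual consists of the
distributions of order at most `m`. -/
def OrderSpace {V : Type*} (G : SimpleGraph V) (o : V) (q : ℕ) (p : ℝ) (_m : ℕ) : Type _ :=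
  Schwartz G o q p

instance : AddCommGroup (OrderSpace G o q p m) := inferInstanceAs (AddCommGroup (Schwartz G o q p))

instance : Module ℂ (OrderSpace G o q p m) := inferInstanceAs (Module ℂ (Schwartz G o q p))

instance : SeminormedAddCommGroup (OrderSpace G o q p m) :=
  AddGroupSeminorm.toSeminormedAddCommGroup (E := OrderSpace G o q p m)
    (show AddGroupSeminorm (OrderSpace G o q p m) from (nuSeminorm G o q p m).toAddGroupSeminorm)

/-- The identity map from `OrderSpace` to the Schwartz space. -/
def OrderSpace.toSchwartz : OrderSpace G o q p m ≃ₗ[ℂ] Schwartz G o q p := LinearEquiv.refl ℂ _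

theorem OrderSpace.ext_val {φ ψ : OrderSpace G o q p m}
    (h : (toSchwartz φ : V → ℂ) = toSchwartz ψ) : φ = ψ :=
  toSchwartz.injective (Subtype.ext h)

theorem OrderSpace.norm_def (φ : OrderSpace G o q p m) :
    ‖φ‖ = nu G o q p m (toSchwartz φ : V → ℂ) := rfl

instance : NormedSpace ℂ (OrderSpace G o q p m) :=
  { (inferInstance : Module ℂ (OrderSpace G o q p m)) with
    norm_smul_le := fun c φ => (nu_smul m c (OrderSpace.toSchwartz φ : V → ℂ)).le }

/-- A linear endomorphism of the Schwartz space that is bounded for `ν_{p,m}`, as a continuous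
linear map. -/
def OrderSpace.mkOp (A : Schwartz G o q p →ₗ[ℂ] Schwartz G o q p) (C : ℝ)
    (hA : ∀ φ, nu G o q p m (A φ : V → ℂ) ≤ C * nu G o q p m (φ : V → ℂ)) :
    OrderSpace G o q p m →L[ℂ] OrderSpace G o q p m :=
  LinearMap.mkContinuous (toSchwartz.symm.toLinearMap ∘ₗ A ∘ₗ toSchwartz.toLinearMap) C
    fun φ => hA (toSchwartz φ)

theorem OrderSpace.norm_mkOp_le (A : Schwartz G o q p →ₗ[ℂ] Schwartz G o q p) {C : ℝ} (hC : 0 ≤ C)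
    (hA : ∀ φ, nu G o q p m (A φ : V → ℂ) ≤ C * nu G o q p m (φ : V → ℂ)) :
    ‖mkOp A C hA‖ ≤ C :=
  LinearMap.mkContinuous_norm_le _ hC fun φ => hA (toSchwartz φ)

end OrderSpace

/-! ### Duals and transposes -/

section Dual

variable {X : Type*} [SeminormedAddCommGroup X] [NormedSpace ℂ X]

variable (X) in
/-- The dual of a seminormed space. It is a type of its own in order to carry a norm: the instance
on `X →L[ℂ] ℂ` is only a seminorm unless `X` is normed. -/
def DualSpace : Type _ := X →L[ℂ] ℂ

instance : SeminormedAddCommGroup (DualSpace X) :=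
  inferInstanceAs (SeminormedAddCommGroup (X →L[ℂ] ℂ))

instance : NormedAddCommGroup (DualSpace X) :=
  NormedAddCommGroup.ofSeparation fun T (hT : ‖(show X →L[ℂ] ℂ from T)‖ = 0) =>
    ContinuousLinearMap.ext fun φ => norm_le_zero_iff.mp <| by
      simpa [hT] using ContinuousLinearMap.le_opNorm (show X →L[ℂ] ℂ from T) φ

instance : NormedSpace ℂ (DualSpace X) := inferInstanceAs (NormedSpace ℂ (X →L[ℂ] ℂ))

instance : CompleteSpace (DualSpace X) := inferInstanceAs (CompleteSpace (X →L[ℂ] ℂ))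

/-- The identity map from `DualSpace X` to the continuous linear functionals on `X`. -/
def DualSpace.toFunctional : DualSpace X ≃ₗ[ℂ] (X →L[ℂ] ℂ) := LinearEquiv.refl ℂ _

theorem DualSpace.ext {S T : DualSpace X} (h : ∀ φ, toFunctional S φ = toFunctional T φ) : S = T :=
  toFunctional.injective (ContinuousLinearMap.ext h)

variable (X) in
/-- The transpose `A ↦ (T ↦ T ∘ A)`. -/
def transpose : (X →L[ℂ] X) →L[ℂ] (DualSpace X →L[ℂ] DualSpace X) :=
  show (X →L[ℂ] X) →L[ℂ] ((X →L[ℂ] ℂ) →L[ℂ] (X →L[ℂ] ℂ)) from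
    (ContinuousLinearMap.compL ℂ X X ℂ).flip

theorem transpose_apply (A : X →L[ℂ] X) (T : DualSpace X) (φ : X) :
    (transpose X A T).toFunctional φ = T.toFunctional (A φ) := rfl

theorem norm_transpose_le (A : X →L[ℂ] X) : ‖transpose X A‖ ≤ ‖A‖ :=
  ContinuousLinearMap.opNorm_le_bound _ (norm_nonneg A) fun T =>
    (T.toFunctional.opNorm_comp_le A).trans (mul_comm _ _).le

theorem transpose_mul (A B : X →L[ℂ] X) : transpose X (A * B) = transpose X B * transpose X A := rfl

theorem transpose_one : transpose X (1 : X →L[ℂ] X) = 1 := rfl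

theorem HeckeSeq.transpose {q : ℕ} {L : ℕ → X →L[ℂ] X} (h : HeckeSeq q L) :
    HeckeSeq q fun n => transpose X (L n) := by
  have hq : HomTree.transpose X (q : X →L[ℂ] X) = q := by
    refine ContinuousLinearMap.ext fun T => DualSpace.ext fun φ => ?_
    rw [transpose_apply, ContinuousLinearMap.natCast_apply, ContinuousLinearMap.natCast_apply,
      map_nsmul, map_nsmul]
    rfl
  refine ⟨by rw [h.zero, transpose_one], ?_, fun n => ?_⟩
  · rw [← transpose_mul, h.one, map_add, map_add, hq, transpose_one]
  · rw [← transpose_mul, ← (h.commute_one _).eq, h.step, map_add,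
      ← (Nat.cast_commute q (L (n + 1))).symm.eq, transpose_mul, hq]

end Dual

/-! ### Decomposition into eigenvectors -/

section Interpolation

theorem aeval_apply_intertwine {E E' : Type*} [NormedAddCommGroup E] [NormedSpace ℂ E]
    [AddCommGroup E'] [Module ℂ E'] (ι : E →ₗ[ℂ] E') (f : E →L[ℂ] E) (g : Module.End ℂ E')
    (h : ∀ x, ι (f x) = g (ι x)) (P : Polynomial ℂ) (x : E) :
    ι (Polynomial.aeval f P x) = Polynomial.aeval g P (ι x) := by
  induction P using Polynomial.induction_on' generalizing x with
  | add P Q hP hQ => simp [hP, hQ]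
  | monomial n c =>
    have : ∀ n x, ι (f^[n] x) = (g ^ n) (ι x) := by
      intro n
      induction n with
      | zero => simp
      | succ n ih =>
        intro x
        rw [Function.iterate_succ_apply, ih, h, pow_succ, Module.End.mul_apply]
    simp [Polynomial.aeval_monomial, Algebra.algebraMap_eq_smul_one, this]

/-- A vector annihilated by `∏ᵢ (f - aᵢ)` with distinct `aᵢ` is in exactly one way a sum of
eigenvectors for the `aᵢ`; the components are given by the Lagrange basis polynomials of `f`. -/
theorem existsUnique_eigen_decomposition {E : Type*} [AddCommGroup E] [Module ℂ E]
    (f : Module.End ℂ E) {j : ℕ} {a : Fin j → ℂ} (ha : Function.Injective a) {x : E}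
    (hx : Polynomial.aeval f (∏ i, (Polynomial.X - Polynomial.C (a i))) x = 0) :
    ∃! S : Fin j → E, x = ∑ i, S i ∧ ∀ i, f (S i) = a i • S i := by
  classical
  rcases Nat.eq_zero_or_pos j with rfl | hj
  · have hx0 : x = 0 := by simpa using hx
    exact ⟨fun _ => 0, ⟨by simp [hx0], fun i => i.elim0⟩, fun S _ => funext fun i => i.elim0⟩
  have : Nonempty (Fin j) := ⟨⟨0, hj⟩⟩
  have hinj : Set.InjOn a (Finset.univ : Finset (Fin j)) := ha.injOn
  have hev : ∀ (P : Polynomial ℂ) (y : E) (c : ℂ), f y = c • y →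
      Polynomial.aeval f P y = P.eval c • y := fun P y c h => by
    induction P using Polynomial.induction_on' with
    | add P Q hP hQ => simp [hP, hQ, add_smul]
    | monomial n b =>
      have : (f ^ n) y = c ^ n • y := by
        induction n with
        | zero => simp
        | succ n ih => rw [pow_succ', Module.End.mul_apply, ih, map_smul, h, smul_smul, pow_succ]
      simp [Polynomial.aeval_monomial, this, smul_smul, mul_comm]
  refine ⟨fun i => Polynomial.aeval f (Lagrange.basis Finset.univ a i) x, ⟨?_, fun i => ?_⟩, ?_⟩
  · rw [← LinearMap.sum_apply, ← map_sum, Lagrange.sum_basis hinj Finset.univ_nonempty]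
    simp
  · have h1 : (Polynomial.X - Polynomial.C (a i)) * Lagrange.basis Finset.univ a i =
        Polynomial.C (∏ l ∈ Finset.univ.erase i, (a i - a l)⁻¹) *
          ∏ l, (Polynomial.X - Polynomial.C (a l)) := by
      rw [Lagrange.basis, ← Finset.mul_prod_erase _ _ (Finset.mem_univ i), map_prod]
      simp only [Lagrange.basisDivisor, Finset.prod_mul_distrib]
      ring
    have h2 := congrArg (fun P => Polynomial.aeval f P x) h1
    simp only [map_mul, Module.End.mul_apply, hx, map_zero] at h2
    simpa [sub_eq_zero] using h2
  · rintro S ⟨hS, hSe⟩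
    funext i
    rw [hS, map_sum, Finset.sum_eq_single i]
    · rw [hev _ _ _ (hSe i), Lagrange.eval_basis_self hinj (Finset.mem_univ i), one_smul]
    · intro l _ hl
      rw [hev _ _ _ (hSe l), Lagrange.eval_basis_of_ne hl.symm (Finset.mem_univ l), zero_smul]
    · simp

end Interpolation

/-! ### The symbol -/

section Symbol

variable {V : Type*} {G : SimpleGraph V} [G.LocallyFinite] {o : V} {q : ℕ} {p : ℝ}

theorem sphereSum_sphericalFunction (hq : 2 ≤ q) (hG : G.IsTree)
    (hreg : G.IsRegularOfDegree (q + 1)) (z : ℂ) :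
    sphereSum G ℂ 1 (sphericalFunction G o q z) =
      ((q : ℂ) ^ (1 / 2 + Complex.I * z) + (q : ℂ) ^ (1 / 2 - Complex.I * z)) •
        sphericalFunction G o q z := by
  have hq1 : (q : ℂ) + 1 ≠ 0 := by exact_mod_cast (by omega : q + 1 ≠ 0)
  funext x
  have h := ((eq_sphericalFunction_iff G q hq hG hreg o z _).mp rfl).2.2 x
  simp only [laplacian, gam] at h
  simp only [sphereSum_apply, sphere_one hG, Pi.smul_apply, smul_eq_mul]
  generalize (q : ℂ) ^ (1 / 2 + Complex.I * z) + (q : ℂ) ^ (1 / 2 - Complex.I * z) = β at h ⊢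
  field_simp at h
  linear_combination -h

theorem heckeSeq_spherical (hq : 2 ≤ q) (hG : G.IsTree)
    (hreg : G.IsRegularOfDegree (q + 1)) (z : ℂ) :
    HeckeSeq q (fun n => sphereSum G ℂ n (sphericalFunction G o q z) o) ∧
      sphereSum G ℂ 1 (sphericalFunction G o q z) o =
        (q : ℂ) ^ (1 / 2 + Complex.I * z) + (q : ℂ) ^ (1 / 2 - Complex.I * z) :=
  heckeSeq_apply_of_eigen hG hreg (by simp [sphericalFunction, sphericalValue])
    (sphereSum_sphericalFunction hq hG hreg z)

theorem norm_sphereSum_spherical_le (hq : 2 ≤ q) (hG : G.IsTree)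
    (hreg : G.IsRegularOfDegree (q + 1)) (hp1 : 1 ≤ p) (hp2 : p < 2) {z : ℂ} (hz : z ∈ strip p)
    (n : ℕ) : ‖sphereSum G ℂ n (sphericalFunction G o q z) o‖ ≤
      2 * ((1 + n) ^ 1 * ((q : ℝ) ^ (1 / p)) ^ n) := by
  obtain ⟨h, h1⟩ := heckeSeq_spherical (o := o) hq hG hreg z
  obtain ⟨hv, hw⟩ := (mem_strip_iff hq hp1 hp2 z).mp hz
  refine (h.norm_le h1 (roots_mul hq z)
    (Real.one_le_rpow (by exact_mod_cast (by omega : 1 ≤ q)) (by positivity)) hv hw n).trans ?_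
  rw [← mul_assoc]
  gcongr
  linarith

theorem sphereSum_radial (hG : G.IsTree) (k : ℕ → ℂ) (f : V → ℂ) (x : V) (n : ℕ) :
    ∑ y ∈ sphere G x n, k (G.dist x y) * f y = k n * sphereSum G ℂ n f x := by
  rw [sphereSum_apply, Finset.mul_sum]
  refine Finset.sum_congr rfl fun y hy => ?_
  rw [(mem_sphere hG).mp hy]

theorem Multiplier.hasSum_symbol (hq : 2 ≤ q) (hG : G.IsTree)
    (hreg : G.IsRegularOfDegree (q + 1)) (hp1 : 1 ≤ p) (hp2 : p < 2) (Λ : Multiplier G o q p)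
    {z : ℂ} (hz : z ∈ strip p) :
    HasSum (fun n => Λ.k n * sphereSum G ℂ n (sphericalFunction G o q z) o) (Λ.symbol z) := by
  have hb := (Λ.exists_summable hq hG hreg 1).mul_left 2
  have hs : Summable fun y => Λ.k (G.dist o y) * sphericalFunction G o q z y := by
    refine summable_of_sphere_le hG o hb fun n => ?_
    -- The spherical function is constant on spheres, so no cancellation occurs in its sums.
    have h1 : ∑ y ∈ sphere G o n, ‖Λ.k (G.dist o y) * sphericalFunction G o q z y‖ =
        ‖Λ.k n‖ * ‖sphereSum G ℂ n (sphericalFunction G o q z) o‖ := by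
      have h2 : ∀ y ∈ sphere G o n, sphericalFunction G o q z y = sphericalValue q z n :=
        fun y hy => by rw [sphericalFunction, (mem_sphere hG).mp hy]
      rw [sphereSum_apply, Finset.sum_congr rfl h2, Finset.sum_congr rfl fun y hy => by
        rw [h2 y hy, (mem_sphere hG).mp hy]]
      simp
      ring
    rw [h1]
    refine (mul_le_mul_of_nonneg_left (norm_sphereSum_spherical_le hq hG hreg hp1 hp2 hz n)
      (norm_nonneg _)).trans (le_of_eq ?_)
    ring
  have h := hasSum_sphere hG o hs
  simp only [sphereSum_radial hG] at h
  exact h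

theorem continuous_sphericalValue (hq : 2 ≤ q) (n : ℕ) :
    Continuous fun z => sphericalValue q z n := by
  have hq0 : (q : ℂ) ≠ 0 := by exact_mod_cast (by omega : q ≠ 0)
  have hg : Continuous (gam q) := by
    unfold gam
    have h1 : Continuous fun z : ℂ => (q : ℂ) ^ (1 / 2 + Complex.I * z) :=
      (by fun_prop : Continuous fun z : ℂ => 1 / 2 + Complex.I * z).const_cpow (.inl hq0)
    have h2 : Continuous fun z : ℂ => (q : ℂ) ^ (1 / 2 - Complex.I * z) :=
      (by fun_prop : Continuous fun z : ℂ => 1 / 2 - Complex.I * z).const_cpow (.inl hq0)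
    fun_prop
  have key : ∀ n, (Continuous fun z => sphericalValue q z n) ∧
      Continuous fun z => sphericalValue q z (n + 1) := by
    intro n
    induction n with
    | zero =>
      simp only [sphericalValue]
      exact ⟨continuous_const, continuous_const.sub hg⟩
    | succ n ih =>
      refine ⟨ih.2, ?_⟩
      have h1 := ih.1
      have h2 := ih.2
      simp only [sphericalValue]
      fun_prop
  exact (key n).1

theorem sphericalValue_congr {z z' : ℂ} (h : gam q z = gam q z') (n : ℕ) :
    sphericalValue q z n = sphericalValue q z' n := by
  have key : ∀ n, sphericalValue q z n = sphericalValue q z' n ∧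
      sphericalValue q z (n + 1) = sphericalValue q z' (n + 1) := by
    intro n
    induction n with
    | zero => simp [sphericalValue, h]
    | succ n ih => exact ⟨ih.2, by simp only [sphericalValue, h, ih.1, ih.2]⟩
  exact (key n).1

theorem gam_add_period (hq : 2 ≤ q) (z : ℂ) :
    gam q (z + ((2 * Real.pi / Real.log q : ℝ) : ℂ)) = gam q z := by
  have hq0 : (q : ℂ) ≠ 0 := by exact_mod_cast (by omega : q ≠ 0)
  have hlog : (Real.log q : ℂ) ≠ 0 := by
    exact_mod_cast (Real.log_pos (by exact_mod_cast (by omega : 1 < q))).ne'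
  have h1 : (q : ℂ) ^ (Complex.I * ((2 * Real.pi / Real.log q : ℝ) : ℂ)) = 1 := by
    rw [Complex.cpow_def_of_ne_zero hq0]
    push_cast
    rw [Complex.natCast_log] at hlog
    rw [show Complex.log q * (Complex.I * (2 * Real.pi / Complex.log q)) =
      2 * Real.pi * Complex.I by field_simp, Complex.exp_two_pi_mul_I]
  unfold gam
  rw [mul_add, ← add_assoc, ← sub_sub, Complex.cpow_add _ _ hq0, Complex.cpow_sub _ _ hq0, h1]
  simp

/-- The symbol attains its maximum modulus: it is continuous on the strip and invariant under a real
period, so that a compact rectangle suffices. -/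
theorem Multiplier.exists_isGreatest (hq : 2 ≤ q) (hG : G.IsTree)
    (hreg : G.IsRegularOfDegree (q + 1)) (hp1 : 1 ≤ p) (hp2 : p < 2) (Λ : Multiplier G o q p) :
    ∃ μ : ℝ, IsGreatest ((fun z => ‖Λ.symbol z‖) '' strip p) μ := by
  have hcont : ContinuousOn Λ.symbol (strip p) := by
    have h : ContinuousOn (fun z => ∑' n, Λ.k n * sphereSum G ℂ n (sphericalFunction G o q z) o)
        (strip p) := by
      refine continuousOn_tsum (fun n => ?_) ((Λ.exists_summable hq hG hreg 1).mul_left 2)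
        fun n z hz => ?_
      · simp only [sphereSum_apply, sphericalFunction]
        refine (continuous_const.mul (continuous_finsetSum _ fun y _ => ?_)).continuousOn
        exact continuous_sphericalValue hq _
      · rw [norm_mul]
        refine (mul_le_mul_of_nonneg_left (norm_sphereSum_spherical_le hq hG hreg hp1 hp2 hz n)
          (norm_nonneg _)).trans (le_of_eq ?_)
        ring
    exact h.congr fun z hz => (Λ.hasSum_symbol hq hG hreg hp1 hp2 hz).tsum_eq.symm
  set P : ℝ := 2 * Real.pi / Real.log q with hP
  have hP0 : 0 < P :=
    div_pos (by positivity) (Real.log_pos (by exact_mod_cast (by omega : 1 < q)))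
  have hper : ∀ z, Λ.symbol (z + (P : ℂ)) = Λ.symbol z := fun z => by
    simp only [Multiplier.symbol, sphericalFunction, sphericalValue_congr (gam_add_period hq z), hP]
  set δ := |1 / p - 1 / 2|
  set R : Set ℂ := Set.Icc 0 P ×ℂ Set.Icc (-δ) δ with hR
  have hRs : R ⊆ strip p := fun z hz => abs_le.mpr hz.2
  have h0 : (0 : ℂ) ∈ R := ⟨⟨le_rfl, hP0.le⟩, by simp [δ], by simp [δ]⟩
  obtain ⟨z₀, hz₀, hmax⟩ := (isCompact_Icc.reProdIm isCompact_Icc).exists_isMaxOn ⟨0, h0⟩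
    (hcont.mono hRs).norm
  refine ⟨‖Λ.symbol z₀‖, ⟨z₀, hRs hz₀, rfl⟩, ?_⟩
  rintro _ ⟨z, hz, rfl⟩
  have hf : Function.Periodic (fun t : ℝ => Λ.symbol (t + z.im * Complex.I)) P := fun t => by
    simp only
    rw [← hper (t + z.im * Complex.I)]
    push_cast
    ring_nf
  obtain ⟨t, ht, hte⟩ := hf.exists_mem_Ico₀ hP0 z.re
  simp only [Complex.re_add_im] at hte
  simp only [hte]
  refine hmax (show _ ∈ R from ⟨?_, ?_⟩)
  · simpa using ⟨ht.1, ht.2.le⟩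
  · simpa using abs_le.mp hz

end Symbol

/-! ### Multipliers as operators -/

section Operators

variable {V : Type*} {G : SimpleGraph V} [G.LocallyFinite] {o : V} {q : ℕ} {p : ℝ}

/-- Summation over spheres as an endomorphism of the Schwartz space. -/
def sphereOp (hq : 2 ≤ q) (hG : G.IsTree) (hreg : G.IsRegularOfDegree (q + 1))
    (hp1 : 1 ≤ p) (hp2 : p < 2) (n : ℕ) : Schwartz G o q p →ₗ[ℂ] Schwartz G o q p :=
  (sphereSum G ℂ n).restrict fun _ hφ => sphereSum_mem hq hG hreg hp1 hp2 hφ n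

/-- Summation over spheres as a bounded operator for `ν_{p,m}`. -/
def sphereCLM (hq : 2 ≤ q) (hG : G.IsTree) (hreg : G.IsRegularOfDegree (q + 1))
    (hp1 : 1 ≤ p) (hp2 : p < 2) (m n : ℕ) : OrderSpace G o q p m →L[ℂ] OrderSpace G o q p m :=
  OrderSpace.mkOp (sphereOp hq hG hreg hp1 hp2 n) ((1 + n) ^ (m + 1) * ((q : ℝ) ^ (1 / p)) ^ n)
    fun φ => nu_le (mul_nonneg (by positivity) (nu_nonneg m (φ : V → ℂ))) fun x =>
      weighted_sphereSum_le hq hG hreg hp1 hp2 φ.2 m n x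

theorem norm_sphereCLM_le (hq : 2 ≤ q) (hG : G.IsTree) (hreg : G.IsRegularOfDegree (q + 1))
    (hp1 : 1 ≤ p) (hp2 : p < 2) (m n : ℕ) :
    ‖sphereCLM (o := o) hq hG hreg hp1 hp2 m n‖ ≤ (1 + n) ^ (m + 1) * ((q : ℝ) ^ (1 / p)) ^ n :=
  OrderSpace.norm_mkOp_le _ (by positivity) _

theorem coe_sphereCLM (hq : 2 ≤ q) (hG : G.IsTree) (hreg : G.IsRegularOfDegree (q + 1))
    (hp1 : 1 ≤ p) (hp2 : p < 2) (m n : ℕ) (φ : OrderSpace G o q p m) :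
    (OrderSpace.toSchwartz (sphereCLM hq hG hreg hp1 hp2 m n φ) : V → ℂ) =
      sphereSum G ℂ n (OrderSpace.toSchwartz φ : V → ℂ) := rfl

theorem heckeSeq_sphereCLM (hq : 2 ≤ q) (hG : G.IsTree) (hreg : G.IsRegularOfDegree (q + 1))
    (hp1 : 1 ≤ p) (hp2 : p < 2) (m : ℕ) :
    HeckeSeq q (sphereCLM (o := o) hq hG hreg hp1 hp2 m) := by
  have hH := heckeSeq_sphereSum hG hreg ℂ
  have hq' : ∀ ψ : OrderSpace G o q p m,
      (q : OrderSpace G o q p m →L[ℂ] OrderSpace G o q p m) ψ = (q : ℂ) • ψ := fun ψ => by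
    rw [ContinuousLinearMap.natCast_apply, Nat.cast_smul_eq_nsmul]
  refine ⟨?_, ?_, fun n => ?_⟩ <;> refine ContinuousLinearMap.ext fun φ => OrderSpace.ext_val ?_
  · exact LinearMap.congr_fun hH.zero _
  · have h := LinearMap.congr_fun hH.one (OrderSpace.toSchwartz φ : V → ℂ)
    simpa [coe_sphereCLM, hq', Nat.cast_smul_eq_nsmul] using h
  · have h := LinearMap.congr_fun (hH.step n) (OrderSpace.toSchwartz φ : V → ℂ)
    simpa [coe_sphereCLM, hq', Nat.cast_smul_eq_nsmul] using h

/-- A multiplier as a bounded operator for `ν_{p,m}`. -/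
def Multiplier.clm (Λ : Multiplier G o q p) (m : ℕ) :
    OrderSpace G o q p m →L[ℂ] OrderSpace G o q p m :=
  OrderSpace.mkOp Λ.op (Λ.bound' m).choose fun φ => (Λ.bound' m).choose_spec.2 _ φ.2

/-- A multiplier is the sum of its kernel against the sphere operators, in operator norm. -/
theorem Multiplier.hasSum_clm (hq : 2 ≤ q) (hG : G.IsTree) (hreg : G.IsRegularOfDegree (q + 1))
    (hp1 : 1 ≤ p) (hp2 : p < 2) (Λ : Multiplier G o q p) (m : ℕ) :
    HasSum (fun n => Λ.k n • sphereCLM (o := o) hq hG hreg hp1 hp2 m n) (Λ.clm m) := by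
  have hb := Λ.exists_summable hq hG hreg (m + 1)
  set b : ℕ → ℝ := fun n => ‖Λ.k n‖ * ((1 + n) ^ (m + 1) * ((q : ℝ) ^ (1 / p)) ^ n) with hbdef
  have hb0 : ∀ n, 0 ≤ b n := fun n => by positivity
  unfold HasSum
  rw [tendsto_iff_norm_sub_tendsto_zero]
  refine squeeze_zero (fun _ => norm_nonneg _) (fun s => ?_) (tendsto_tsum_compl_atTop_zero b)
  rw [norm_sub_rev]
  have hts : 0 ≤ ∑' n : {n // n ∉ s}, b n := tsum_nonneg fun n => hb0 n
  refine ContinuousLinearMap.opNorm_le_bound _ hts fun φ => ?_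
  set φ' : Schwartz G o q p := OrderSpace.toSchwartz φ with hφ'
  rw [OrderSpace.norm_def, OrderSpace.norm_def]
  refine nu_le (mul_nonneg hts (nu_nonneg _ _)) fun x => ?_
  have hval : (OrderSpace.toSchwartz
      ((Λ.clm m - ∑ n ∈ s, Λ.k n • sphereCLM (o := o) hq hG hreg hp1 hp2 m n) φ) : V → ℂ) x =
      conv G φ' Λ.k x - ∑ n ∈ s, Λ.k n * sphereSum G ℂ n φ' x := by
    rw [sub_apply, map_sub, sum_apply, map_sum]
    simp only [smul_apply, map_smul, Submodule.coe_sub, Submodule.coe_sum, Submodule.coe_smul,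
      Pi.sub_apply, Finset.sum_apply, Pi.smul_apply, smul_eq_mul, coe_sphereCLM, hφ']
    rfl
  have hsum : HasSum (fun n => Λ.k n * sphereSum G ℂ n φ' x) (conv G φ' Λ.k x) := by
    have h := hasSum_sphere hG x (Λ.summable' _ φ'.2 x)
    simp only [mul_comm _ (Λ.k _), sphereSum_radial hG] at h
    simpa only [conv, mul_comm _ (Λ.k _)] using h
  have htail : conv G φ' Λ.k x - ∑ n ∈ s, Λ.k n * sphereSum G ℂ n φ' x =
      ∑' n : {n // n ∉ s}, Λ.k n * sphereSum G ℂ n φ' x := by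
    rw [← hsum.tsum_eq, ← hsum.summable.sum_add_tsum_subtype_compl s]
    ring
  have hW := weighted_eq (G := G) (o := o) (q := q) (p := p) m
  set c : ℝ := (1 + (G.dist o x : ℝ)) ^ m * ((q : ℝ) ^ (1 / p)) ^ G.dist o x with hc
  have hc0 : 0 < c := by
    have : (0 : ℝ) < q := by exact_mod_cast (by omega : 0 < q)
    positivity
  rw [hW, hval, htail]
  have hbs := (hb.subtype fun n => n ∉ s).mul_right (nu G o q p m (φ' : V → ℂ) / c)
  have hnorm : ‖∑' n : {n // n ∉ s}, Λ.k n * sphereSum G ℂ n φ' x‖ ≤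
      ∑' n : {n // n ∉ s}, b n * (nu G o q p m (φ' : V → ℂ) / c) := by
    refine tsum_of_norm_bounded hbs.hasSum fun n => ?_
    rw [norm_mul, Function.comp_apply, hbdef, mul_assoc]
    refine mul_le_mul_of_nonneg_left ?_ (norm_nonneg _)
    have h := weighted_sphereSum_le hq hG hreg hp1 hp2 φ'.2 m n x
    rw [hW] at h
    rw [← mul_div_assoc, le_div_iff₀ hc0]
    refine le_trans (le_of_eq ?_) h
    ring
  rw [tsum_mul_right, ← mul_div_assoc, le_div_iff₀ hc0] at hnorm
  rw [mul_comm]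
  exact hnorm

/-- Off the range of the symbol, a multiplier minus a scalar is invertible on the distributions of
order at most `m`. -/
theorem Multiplier.isUnit_transpose_sub (hq : 2 ≤ q) (hG : G.IsTree)
    (hreg : G.IsRegularOfDegree (q + 1)) (hp1 : 1 ≤ p) (hp2 : p < 2) (Λ : Multiplier G o q p)
    (m : ℕ) {c : ℂ} (hc : c ∉ Λ.symbol '' strip p) :
    IsUnit (transpose _ (Λ.clm m) - algebraMap ℂ _ c) := by
  refine isUnit_sub_of_forall_not_hasSum hq hp1 hp2
    (heckeSeq_sphereCLM (o := o) hq hG hreg hp1 hp2 m).transpose (C := 1) (s := m + 1)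
    (fun n => ?_) (k := Λ.k) ?_ fun z hz x hx hx1 hs => hc ⟨z, hz, ?_⟩
  · rw [one_mul]
    exact (norm_transpose_le _).trans (norm_sphereCLM_le hq hG hreg hp1 hp2 m n)
  · simpa [Function.comp_def] using
      (Λ.hasSum_clm hq hG hreg hp1 hp2 m).map (transpose _) (transpose _).continuous
  · obtain ⟨h, h1⟩ := heckeSeq_spherical (o := o) hq hG hreg z
    rw [hx.eq_of_one h (hx1.trans h1.symm)] at hs
    exact (Λ.hasSum_symbol hq hG hreg hp1 hp2 hz).unique hs

variable (G o q p) in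
/-- The inclusion of the distributions of order at most `m` in the tempered distributions. -/
def orderInclusion (m : ℕ) : DualSpace (OrderSpace G o q p m) →ₗ[ℂ] Tempered G o q p where
  toFun T := ⟨T.toFunctional.toLinearMap ∘ₗ OrderSpace.toSchwartz.symm.toLinearMap, fun φ hφ => by
    refine squeeze_zero_norm (fun n => T.toFunctional.le_opNorm (OrderSpace.toSchwartz.symm (φ n)))
      ?_
    have h := (hφ m).const_mul ‖T.toFunctional‖
    rw [mul_zero] at h
    exact h⟩
  map_add' _ _ := rfl
  map_smul' _ _ := rfl

/-- The polynomial with simple roots at the values of modulus `‖A‖` of the symbol annihilates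
`T 0`. -/
theorem Multiplier.aeval_act_apply_eq_zero (hq : 2 ≤ q) (hG : G.IsTree)
    (hreg : G.IsRegularOfDegree (q + 1)) (hp1 : 1 ≤ p) (hp2 : p < 2) (Λ : Multiplier G o q p)
    (T : ℤ → Tempered G o q p) {A : ℂ} (hA : A ≠ 0) (hT : ∀ k : ℤ, Λ.act (T k) = A • T (k + 1))
    (m : ℕ) {M : ℝ} (hM : 0 < M)
    (hbd : ∀ (k : ℤ) (φ : Schwartz G o q p),
      ‖(T k : Schwartz G o q p →ₗ[ℂ] ℂ) φ‖ ≤ M * nu G o q p m (φ : V → ℂ))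
    {j : ℕ} {a : Fin j → ℂ} (ha : Function.Injective a) (haA : ∀ i, ‖a i‖ = ‖A‖)
    (hr : ∀ w ∈ Λ.symbol '' strip p, ‖w‖ = ‖A‖ → w ∈ Set.range a) :
    Polynomial.aeval Λ.act (∏ i, (Polynomial.X - Polynomial.C (a i))) (T 0) = 0 := by
  classical
  let T' : ℤ → DualSpace (OrderSpace G o q p m) := fun k => DualSpace.toFunctional.symm <|
    LinearMap.mkContinuous ((T k : Schwartz G o q p →ₗ[ℂ] ℂ) ∘ₗ OrderSpace.toSchwartz.toLinearMap)
      M fun φ => hbd k (OrderSpace.toSchwartz φ)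
  have hι : ∀ k, orderInclusion G o q p m (T' k) = T k := fun k => rfl
  set B := transpose _ (Λ.clm m) with hB
  have hBT : ∀ k, B (T' k) = A • T' (k + 1) := fun k => DualSpace.ext fun φ =>
    LinearMap.congr_fun (congrArg Subtype.val (hT k)) φ
  have hA' : ‖A‖ ≠ 0 := norm_ne_zero_iff.mpr hA
  set F : Finset ℂ := Finset.univ.image fun i => A⁻¹ * a i with hF
  have hF1 : ∀ w ∈ F, ‖w‖ = 1 := by
    intro w hw
    obtain ⟨i, -, rfl⟩ := Finset.mem_image.mp hw
    rw [norm_mul, norm_inv, haA, inv_mul_cancel₀ hA']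
  have hU : ∀ w : ℂ, ‖w‖ = 1 → w ∉ F → IsUnit (A⁻¹ • B - algebraMap ℂ _ w) := by
    intro w hw hwF
    have hAw : A * w ∉ Λ.symbol '' strip p := by
      intro h
      obtain ⟨i, hi⟩ := hr _ h (by rw [norm_mul, hw, mul_one])
      exact hwF (Finset.mem_image.mpr ⟨i, Finset.mem_univ i, by rw [hi, inv_mul_cancel_left₀ hA]⟩)
    have h := Λ.isUnit_transpose_sub hq hG hreg hp1 hp2 m hAw
    have e : A⁻¹ • B - algebraMap ℂ _ w = (Units.mk0 A hA)⁻¹ • (B - algebraMap ℂ _ (A * w)) := by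
      rw [Units.smul_def, smul_sub, Algebra.algebraMap_eq_smul_one, Algebra.algebraMap_eq_smul_one,
        smul_smul]
      simp [hA]
    rw [e]
    exact h.smul _
  have hTorb : ∀ k, (A⁻¹ • B) (T' k) = T' (k + 1) := fun k => by
    rw [smul_apply, hBT, inv_smul_smul₀ hA]
  have hTM : ∀ k, ‖T' k‖ ≤ M := fun k =>
    LinearMap.mkContinuous_norm_le _ hM.le fun φ => hbd k (OrderSpace.toSchwartz φ)
  have hz := aeval_prod_apply_eq_zero (A⁻¹ • B) F hF1 T' hTorb M hTM
    (exists_carlemanExtension (A⁻¹ • B) F hU T' hTorb M hTM)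
  rw [hF, Finset.prod_image fun i _ l _ h => ha (mul_left_cancel₀ (inv_ne_zero hA) h)] at hz
  have hlin : ∀ P : Polynomial ℂ, Polynomial.aeval (A⁻¹ • B) P (T' 0) = 0 →
      Polynomial.aeval (A⁻¹ • Λ.act) P (T 0) = 0 := by
    intro P hP
    rw [← hι 0, ← aeval_apply_intertwine (orderInclusion G o q p m) (A⁻¹ • B) (A⁻¹ • Λ.act)
      (fun _ => rfl), hP, map_zero]
  have h2 := hlin _ hz
  have h3 : (∏ i, (Polynomial.X - Polynomial.C (a i))) = Polynomial.C (A ^ j) *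
      (∏ i, (Polynomial.X - Polynomial.C (A⁻¹ * a i))).comp (Polynomial.C A⁻¹ * Polynomial.X) := by
    have hc : Polynomial.C (A ^ j) = ∏ _i : Fin j, Polynomial.C A := by simp
    rw [Polynomial.prod_comp, hc, ← Finset.prod_mul_distrib]
    refine Finset.prod_congr rfl fun i _ => ?_
    simp only [Polynomial.sub_comp, Polynomial.X_comp, Polynomial.C_comp, mul_sub, ← mul_assoc,
      ← Polynomial.C_mul, mul_inv_cancel₀ hA]
    simp
  rw [h3, map_mul, Module.End.mul_apply, Polynomial.aeval_comp]
  have h4 : Polynomial.aeval Λ.act (Polynomial.C A⁻¹ * Polynomial.X) = A⁻¹ • Λ.act := by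
    rw [map_mul, Polynomial.aeval_C, Polynomial.aeval_X, Algebra.smul_def]
  rw [h4, h2, map_zero]

end Operators

end HomTree

end

theorem theorem4p3 {V : Type*} (G : SimpleGraph V) [G.LocallyFinite] (q : ℕ) (hq : 2 ≤ q)
    (hG : G.IsTree) (hreg : G.IsRegularOfDegree (q + 1)) (o : V)
    (p : ℝ) (hp1 : 1 ≤ p) (hp2 : p < 2)
    (Λ : HomTree.Multiplier G o q p) (hΛ : ∃ z ∈ HomTree.strip p, Λ.symbol z ≠ 0)
    (T : ℤ → HomTree.Tempered G o q p) (A : ℂ) (hA : A ≠ 0)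
    (hT : ∀ k : ℤ, Λ.act (T k) = A • T (k + 1))
    (m : ℕ) (M : ℝ) (hM : 0 < M)
    (hbd : ∀ (k : ℤ) (φ : HomTree.Schwartz G o q p),
      ‖(T k : HomTree.Schwartz G o q p →ₗ[ℂ] ℂ) φ‖ ≤ M * HomTree.nu G o q p m (φ : V → ℂ)) :
    ∃ μ : ℝ, IsGreatest ((fun z => ‖Λ.symbol z‖) '' HomTree.strip p) μ ∧
      (‖A‖ = μ → ∀ (j : ℕ) (a : Fin j → ℂ), Function.Injective a →
        Set.range a = (Λ.symbol '' HomTree.strip p) ∩ {w : ℂ | ‖w‖ = ‖A‖} →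
        ∃! S : Fin j → HomTree.Tempered G o q p,
          T 0 = ∑ i, S i ∧ ∀ i, Λ.act (S i) = a i • S i) ∧
      (μ < ‖A‖ → T 0 = 0) := by
  obtain ⟨μ, hμ⟩ := Λ.exists_isGreatest hq hG hreg hp1 hp2
  refine ⟨μ, hμ, fun _ j a ha hr => ?_, fun hlt => ?_⟩
  · refine HomTree.existsUnique_eigen_decomposition Λ.act ha
      (Λ.aeval_act_apply_eq_zero hq hG hreg hp1 hp2 T hA hT m hM hbd ha (fun i => ?_)
        fun w hw hwA => ?_)
    · have := hr.subset (Set.mem_range_self i)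
      exact this.2
    · rw [hr]
      exact ⟨hw, hwA⟩
  · -- No value of the symbol has modulus `‖A‖`, and the annihilating polynomial is `1`.
    have h := Λ.aeval_act_apply_eq_zero hq hG hreg hp1 hp2 T hA hT m hM hbd (j := 0)
      (a := Fin.elim0) (fun i => i.elim0) (fun i => i.elim0) (by
        rintro _ ⟨z, hz, rfl⟩ hzA
        exact absurd (hμ.2 ⟨z, hz, rfl⟩) (by simpa [hzA] using hlt))
    simpa using h
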